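/- Let $\mathfrak H_1,\mathfrak H_2$ be complex Hilbert spaces, $\mathfrak H=\mathfrak H_1\oplus\mathfrak H_2$, and let $$T^\circ=\begin{pmatrix}T_{11}^\circ&T_{12}^\circ\\ T_{21}^\circ&T_{22}^\circ\end{pmatrix}$$ be a densely defined symmetric operator matrix with domain $\operatorname{dom}T_{11}^\circ\oplus\operatorname{dom}T_{22}^\circ$ (so that $T_{21}^\circ$ is defined on $\operatorname{dom}T_{11}^\circ$ and $T_{12}^\circ$ on $\operatorname{dom}T_{22}^\circ$), where $T_{11}^\circ$ is bounded below and $T_{22}^\circ$ is bounded above. Fix $\varkappa,\tau\in\mathbb R$ with $\langle(T_{11}^\circ-\varkappa)y,y\rangle\ge\|y\|^2$ on $\operatorname{dom}T_{11}^\circ$ and $\langle(\tau-T_{22}^\circ)y,y\rangle\ge\|y\|^2$ on $\operatorname{dom}T_{22}^\circ$. Let $\mathfrak D_2$ be the completion of $\operatorname{dom}T_{22}^\circ$ in the norm $\langle(\tau-T_{22}^\circ)y,y\rangle^{1/2}$, let $T_{22}^\bullet$ be the Friedrichs extension of $T_{22}^\circ$, and let $\mathfrak D_1$ be the completion of $\operatorname{dom}T_{11}^\circ$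 in the norm $$\bigl[\langle(T_{11}^\circ-\varkappa)y,y\rangle+\langle(\tau-T_{22}^\bullet)^{-1}T_{21}^\circ y,T_{21}^\circ y\rangle\bigr]^{1/2}.$$ Let $I_j:\mathfrak D_j\to\mathfrak H_j$ be the natural embeddings, $\mathfrak D=\mathfrak D_1\oplus\mathfrak D_2$, $I=I_1\oplus I_2:\mathfrak D\to\mathfrak H$, let $\mathfrak D_j^*$ and $\mathfrak D^*$ be the spaces of bounded conjugate-linear functionals on $\mathfrak D_j$ and $\mathfrak D$, and let $I_j^*:\mathfrak H_j\to\mathfrak D_j^*$, $I^*:\mathfrak H\to\mathfrak D^*$ be the corresponding dual maps. Let $T_{ij}:\mathfrak D_j\to\mathfrak D_i^*$ be the bounded operator that extends $I_i^*T_{ij}^\circ I_j$ by continuity, let $T:\mathfrak D\to\mathfrak D^*$ be the operator with the entries $T_{ij}$, and let $T^\bullet=(I^*)^{-1}TI^{-1}$ (the angular extension of $T^\circ$), an operator in $\mathfrak H$. For real $\lambda$ in the resolvent set $\varrho(T_{22}^\bullet)$ put $$S(\lambda)=T_{11}-\lambda I_1^*I_1-T_{12}(T_{22}-\lambda I_2^*I_2)^{-1}T_{21}:\mathfrak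 D_1\to\mathfrak D_1^*,$$ and let $\operatorname{ind}S(\lambda)\in\{0,1,2,\dots,\infty\}$ be the supremum of the dimensions of the subspaces $\mathfrak M\subseteq\mathfrak D_1$ such that $\langle S(\lambda)y,y\rangle<0$ for all $y\in\mathfrak M\setminus\{0\}$. Let $\zeta\in\mathbb R$ belong to $\varrho(T^\bullet)$, let $[\zeta,+\infty)\subseteq\varrho(T_{22}^\bullet)$, and let $\operatorname{ind}S(\zeta)$ be finite. Let $\lambda_e\in(-\infty,+\infty]$ be the infimum of the intersection of the essential spectrum of $T^\bullet$ (the spectrum without the isolated eigenvalues of finite multiplicity) with $(\zeta,+\infty)$, where $\inf\varnothing=+\infty$. For $n=0,1,2,\dots$ let $\lambda_n$ be the $(n+1)$-st eigenvalue from below, counted with multiplicity, of $T^\bullet$ in $(\zeta,\lambda_e)$, or $\lambda_n=\lambda_e$ if there is no such eigenvalue. Then for every $n=0,1,2,\dots$ $$\lambda_n=\inf\{\lambda\in(\zeta,+\infty):\operatorname{ind}S(\lambda)>\operatorname{ind}S(\zeta)+n\}.$$ -/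

import Mathlib

open scoped InnerProductSpace ComplexConjugate

noncomputable section

/-! ### Completion of a complex vector space with respect to an inner product -/

section FormCompletion

variable {V : Type*} [AddCommGroup V] [Module ℂ V]

/-- The vector space `V`, considered with the norm given by the inner product `c`. -/
def FormSpace (_c : InnerProductSpace.Core ℂ V) : Type _ := V

instance (c : InnerProductSpace.Core ℂ V) : NormedAddCommGroup (FormSpace c) :=
  @InnerProductSpace.Core.toNormedAddCommGroup ℂ V _ _ _ c

instance (c : InnerProductSpace.Core ℂ V) : InnerProductSpace ℂ (FormSpace c) :=
  @InnerProductSpace.ofCore ℂ V _ _ _ c.toCore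

/-- The Hilbert space obtained by completing `V` with respect to the inner product `c`. -/
def FormCompletion (c : InnerProductSpace.Core ℂ V) : Type _ :=
  UniformSpace.Completion (FormSpace c)

instance (c : InnerProductSpace.Core ℂ V) : NormedAddCommGroup (FormCompletion c) :=
  inferInstanceAs (NormedAddCommGroup (UniformSpace.Completion (FormSpace c)))

instance (c : InnerProductSpace.Core ℂ V) : InnerProductSpace ℂ (FormCompletion c) :=
  inferInstanceAs (InnerProductSpace ℂ (UniformSpace.Completion (FormSpace c)))

instance (c : InnerProductSpace.Core ℂ V) : CompleteSpace (FormCompletion c) :=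
  inferInstanceAs (CompleteSpace (UniformSpace.Completion (FormSpace c)))

/-- The canonical linear map of `V` into its completion. -/
def toFormCompletion (c : InnerProductSpace.Core ℂ V) : V →ₗ[ℂ] FormCompletion c :=
  (UniformSpace.Completion.toComplₗᵢ (𝕜 := ℂ) (E := FormSpace c)).toLinearMap

theorem inner_toFormCompletion (c : InnerProductSpace.Core ℂ V) (x y : V) :
    ⟪toFormCompletion c x, toFormCompletion c y⟫_ℂ = c.inner x y :=
  UniformSpace.Completion.inner_coe (𝕜 := ℂ) (E := FormSpace c) x y

theorem denseRange_toFormCompletion (c : InnerProductSpace.Core ℂ V) :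
    DenseRange (toFormCompletion c) :=
  UniformSpace.Completion.denseRange_coe (α := FormSpace c)

theorem norm_sq_toFormCompletion (c : InnerProductSpace.Core ℂ V) (x : V) :
    ‖toFormCompletion c x‖ ^ 2 = (c.inner x x).re := by
  rw [← inner_toFormCompletion, ← inner_self_eq_norm_sq (𝕜 := ℂ)]
  rfl

end FormCompletion

/-! ### Unbounded operators: resolvent set, eigenvalues, essential spectrum -/

section Unbounded

variable {H : Type*} [NormedAddCommGroup H] [InnerProductSpace ℂ H]

/-- `R` is a bounded everywhere defined two-sided inverse of `A - z`. -/
def IsResolventAt (A : H →ₗ.[ℂ] H) (z : ℂ) (R : H →L[ℂ] H) : Prop :=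
  (∀ x : A.domain, R (A x - z • (x : H)) = x) ∧
    ∀ y : H, ∃ h : R y ∈ A.domain, A ⟨R y, h⟩ - z • R y = y

/-- The resolvent set of an unbounded operator. -/
def opResolventSet (A : H →ₗ.[ℂ] H) : Set ℂ := {z | ∃ R : H →L[ℂ] H, IsResolventAt A z R}

/-- The spectrum of an unbounded operator. -/
def opSpectrum (A : H →ₗ.[ℂ] H) : Set ℂ := (opResolventSet A)ᶜ

/-- The kernel of `A - z`. -/
def opEigenspace (A : H →ₗ.[ℂ] H) (z : ℂ) : Submodule ℂ H where
  carrier := {x | ∃ h : x ∈ A.domain, A ⟨x, h⟩ = z • x}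
  zero_mem' := ⟨A.domain.zero_mem, by rw [smul_zero]; exact A.map_zero⟩
  add_mem' := by
    rintro x y ⟨hx, ex⟩ ⟨hy, ey⟩
    refine ⟨A.domain.add_mem hx hy, ?_⟩
    have := A.map_add ⟨x, hx⟩ ⟨y, hy⟩
    rw [smul_add, ← ex, ← ey, ← this]
    rfl
  smul_mem' := by
    rintro a x ⟨hx, ex⟩
    refine ⟨A.domain.smul_mem a hx, ?_⟩
    have := A.map_smul a ⟨x, hx⟩
    rw [smul_comm, ← ex, ← this]
    rfl

/-- The multiplicity of `z` as an eigenvalue of `A` (zero if it is not an eigenvalue). -/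
def eigMult (A : H →ₗ.[ℂ] H) (z : ℂ) : ℕ∞ :=
  Cardinal.toENat (Module.rank ℂ (opEigenspace A z))

/-- The discrete spectrum: isolated points of the spectrum that are eigenvalues of finite
multiplicity. -/
def discreteSpectrum (A : H →ₗ.[ℂ] H) : Set ℂ :=
  {z | z ∈ opSpectrum A ∧ (∃ ε > 0, ∀ w ∈ opSpectrum A, w ≠ z → ε ≤ dist w z) ∧
    0 < eigMult A z ∧ eigMult A z < ⊤}

/-- The essential spectrum (of a self-adjoint operator). -/
def essentialSpectrum (A : H →ₗ.[ℂ] H) : Set ℂ := opSpectrum A \ discreteSpectrum A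

/-- The number of eigenvalues of `A` in the set `J` of reals, counted with multiplicity: an
eigenvalue `μ` of multiplicity `m` contributes the pairs `(μ, 0), …, (μ, m - 1)`. -/
def eigCount (A : H →ₗ.[ℂ] H) (J : Set ℝ) : ℕ∞ :=
  {p : ℝ × ℕ | p.1 ∈ J ∧ (p.2 : ℕ∞) < eigMult A (p.1 : ℂ)}.encard

/-- `μ` is the `(n + 1)`-st eigenvalue of `A` in `J` from below, counted with multiplicity. -/
def IsNthEigenvalue (A : H →ₗ.[ℂ] H) (J : Set ℝ) (n : ℕ) (μ : ℝ) : Prop :=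
  μ ∈ J ∧ 0 < eigMult A (μ : ℂ) ∧
    eigCount A (J ∩ Set.Iio μ) ≤ n ∧ (n : ℕ∞) < eigCount A (J ∩ Set.Iic μ)

/-- The infimum of the part of the essential spectrum in `(ζ, +∞)`; it is `+∞` if this part is
empty. -/
def essBottom (A : H →ₗ.[ℂ] H) (ζ : ℝ) : EReal :=
  sInf ((fun x : ℝ ↦ (x : EReal)) '' {x : ℝ | ζ < x ∧ (x : ℂ) ∈ essentialSpectrum A})

/-- The interval from `ζ` to the bottom of the essential spectrum above `ζ`. -/
def gapAbove (A : H →ₗ.[ℂ] H) (ζ : ℝ) : Set ℝ := {x : ℝ | ζ < x ∧ (x : EReal) < essBottom A ζ}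

open Classical in
/-- The `(n + 1)`-st eigenvalue of `A` from below between `ζ` and the bottom of the essential
spectrum above `ζ`, or that bottom if there is no such eigenvalue. -/
def nthLevel (A : H →ₗ.[ℂ] H) (ζ : ℝ) (n : ℕ) : EReal :=
  if h : ∃ μ : ℝ, IsNthEigenvalue A (gapAbove A ζ) n μ then ((h.choose : ℝ) : EReal)
  else essBottom A ζ

theorem IsNthEigenvalue.unique {A : H →ₗ.[ℂ] H} {J : Set ℝ} {n : ℕ} {μ ν : ℝ}
    (hμ : IsNthEigenvalue A J n μ) (hν : IsNthEigenvalue A J n ν) : μ = ν := by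
  have key : ∀ {a b : ℝ}, IsNthEigenvalue A J n a → IsNthEigenvalue A J n b → ¬ a < b := by
    intro a b ha hb hab
    refine absurd (ha.2.2.2.trans_le ?_) (not_lt.2 hb.2.2.1)
    refine Set.encard_le_encard fun p hp ↦ ⟨⟨hp.1.1, ?_⟩, hp.2⟩
    exact lt_of_le_of_lt hp.1.2 hab
  exact le_antisymm (not_lt.1 (key hν hμ)) (not_lt.1 (key hμ hν))

end Unbounded

/-! ### Rigged spaces `D → H → D*` and operators in them -/

section Rigged

variable {H : Type*} [NormedAddCommGroup H] [InnerProductSpace ℂ H]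
variable {D : Type*} [NormedAddCommGroup D] [InnerProductSpace ℂ D]

/-- The space `D*` of bounded conjugate-linear functionals on `D`. -/
abbrev AntiDual (D : Type*) [NormedAddCommGroup D] [InnerProductSpace ℂ D] : Type _ :=
  D →L⋆[ℂ] ℂ

/-- The map `I* : H → D*`; the functional `I* h` takes `y` to the product of `h` and `I y`. -/
def dualEmb (I : D →L[ℂ] H) : H →L[ℂ] AntiDual D :=
  (ContinuousLinearMap.precomp ℂ I).comp (innerSLFlip ℂ)

@[simp]
theorem dualEmb_apply (I : D →L[ℂ] H) (h : H) (y : D) : dualEmb I h y = ⟪I y, h⟫_ℂ := rfl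

/-- The graph `{(I y, h) | T y = I* h}` of the operator `(I*)⁻¹ T I⁻¹`. -/
def bulletGraph (I : D →L[ℂ] H) (T : D →L[ℂ] AntiDual D) : Submodule ℂ (H × H) where
  carrier := {p | ∃ y : D, I y = p.1 ∧ T y = dualEmb I p.2}
  zero_mem' := ⟨0, by simp, by simp⟩
  add_mem' := by
    rintro p q ⟨x, hx, hx'⟩ ⟨y, hy, hy'⟩
    exact ⟨x + y, by simp [hx, hy], by simp [hx', hy']⟩
  smul_mem' := by
    rintro a p ⟨x, hx, hx'⟩
    exact ⟨a • x, by simp [hx], by simp [hx']⟩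

/-- The unbounded operator `T^• = (I*)⁻¹ T I⁻¹` in `H`. -/
def bullet (I : D →L[ℂ] H) (T : D →L[ℂ] AntiDual D) : H →ₗ.[ℂ] H :=
  (bulletGraph I T).toLinearPMap

theorem extendOfNorm_eq_of_comp {V E F : Type*} [AddCommGroup V] [Module ℂ V]
    [NormedAddCommGroup E] [NormedSpace ℂ E] [NormedAddCommGroup F] [NormedSpace ℂ F]
    [CompleteSpace F] {f : V →ₗ[ℂ] F} {e : V →ₗ[ℂ] E} (he : DenseRange e) {g : E →L[ℂ] F}
    (h : ∀ x, g (e x) = f x) : f.extendOfNorm e = g :=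
  LinearMap.extendOfNorm_unique he ‖g‖ (fun x ↦ by rw [← h]; exact g.le_opNorm _) g
    (LinearMap.ext h)

theorem dualEmb_injective {I : D →L[ℂ] H} (hI : DenseRange I) :
    Function.Injective (dualEmb I) := by
  rw [injective_iff_map_eq_zero]
  intro h hh
  refine (hI : Dense (Set.range I)).eq_zero_of_inner_right (𝕜 := ℂ) ?_
  intro y
  exact DFunLike.congr_fun hh y

theorem bullet_graph {I : D →L[ℂ] H} (hI : Function.Injective I) (hd : DenseRange I)
    (T : D →L[ℂ] AntiDual D) : (bullet I T).graph = bulletGraph I T := by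
  refine Submodule.toLinearPMap_graph_eq _ ?_
  rintro ⟨a, b⟩ ⟨y, hy, hy'⟩ h
  obtain rfl : y = 0 := hI (by rw [hy, map_zero]; exact h)
  exact dualEmb_injective hd (by rw [← hy', map_zero, map_zero])

/-- The negative index of inertia of the form `y ↦ ⟨A y, y⟩`: the supremum of the dimensions of
the subspaces on which the form is negative. -/
def negIndex (A : D →L[ℂ] AntiDual D) : ℕ∞ :=
  ⨆ (L : Submodule ℂ D) (_ : ∀ y ∈ L, y ≠ 0 → (A y y).re < 0),
    Cardinal.toENat (Module.rank ℂ L)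

end Rigged

/-! ### Symmetric block operator matrices and their angular extensions -/

/-- A densely defined symmetric operator matrix with entries `Tᵢⱼ`, with domain
`dom₁ ⊕ dom₂ ⊆ H₁ ⊕ H₂`. -/
structure SymmBlockMatrix (H₁ H₂ : Type*) [NormedAddCommGroup H₁] [InnerProductSpace ℂ H₁]
    [NormedAddCommGroup H₂] [InnerProductSpace ℂ H₂] where
  dom₁ : Submodule ℂ H₁
  dom₂ : Submodule ℂ H₂
  dense₁ : Dense (dom₁ : Set H₁)
  dense₂ : Dense (dom₂ : Set H₂)
  T₁₁ : dom₁ →ₗ[ℂ] H₁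
  T₁₂ : dom₂ →ₗ[ℂ] H₁
  T₂₁ : dom₁ →ₗ[ℂ] H₂
  T₂₂ : dom₂ →ₗ[ℂ] H₂
  symm₁₁ : ∀ x y : dom₁, ⟪T₁₁ x, (y : H₁)⟫_ℂ = ⟪(x : H₁), T₁₁ y⟫_ℂ
  symm₂₂ : ∀ x y : dom₂, ⟪T₂₂ x, (y : H₂)⟫_ℂ = ⟪(x : H₂), T₂₂ y⟫_ℂ
  symm₁₂ : ∀ (x : dom₂) (y : dom₁), ⟪T₁₂ x, (y : H₁)⟫_ℂ = ⟪(x : H₂), T₂₁ y⟫_ℂ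

namespace SymmBlockMatrix

variable {H₁ H₂ : Type*} [NormedAddCommGroup H₁] [InnerProductSpace ℂ H₁]
  [NormedAddCommGroup H₂] [InnerProductSpace ℂ H₂]

/-- Real numbers `κ` and `τ` with `T₁₁ - κ ≥ 1` and `τ - T₂₂ ≥ 1`. They exist if and only if `T₁₁`
is bounded below and `T₂₂` is bounded above. -/
structure Shifts (M : SymmBlockMatrix H₁ H₂) where
  κ : ℝ
  τ : ℝ
  lower : ∀ y : M.dom₁, ‖(y : H₁)‖ ^ 2 ≤ (⟪M.T₁₁ y - (κ : ℂ) • (y : H₁), (y : H₁)⟫_ℂ).re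
  upper : ∀ y : M.dom₂, ‖(y : H₂)‖ ^ 2 ≤ (⟪(τ : ℂ) • (y : H₂) - M.T₂₂ y, (y : H₂)⟫_ℂ).re

namespace Shifts

variable {M : SymmBlockMatrix H₁ H₂} (s : M.Shifts)

/-- The inner product `⟨(τ - T₂₂) x, y⟩` on `dom₂`. -/
@[reducible]
def core₂ : InnerProductSpace.Core ℂ M.dom₂ where
  inner x y := ⟪(s.τ : ℂ) • (x : H₂) - M.T₂₂ x, (y : H₂)⟫_ℂ
  conj_inner_symm x y := by
    simp only [inner_sub_left, inner_smul_left, map_sub, map_mul, inner_conj_symm,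
      Complex.conj_ofReal]
    rw [M.symm₂₂ x y]
  re_inner_nonneg x := le_trans (sq_nonneg _) (s.upper x)
  add_left x y z := by
    simp only [Submodule.coe_add, map_add, smul_add, inner_sub_left, inner_add_left]
    ring
  smul_left x y r := by
    simp only [Submodule.coe_smul, map_smul, inner_sub_left, inner_smul_left]
    ring
  definite x hx := by
    have h := s.upper x
    rw [hx] at h
    have : ‖(x : H₂)‖ = 0 := by
      have := sq_nonneg ‖(x : H₂)‖
      exact pow_eq_zero_iff two_ne_zero |>.1 (le_antisymm (by simpa using h) this)
    exact Subtype.ext (norm_eq_zero.1 this)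

/-- The Hilbert space `D₂`: the completion of `dom₂` in the norm `⟨(τ - T₂₂) y, y⟩ ^ (1/2)`. -/
abbrev D₂ : Type _ := FormCompletion s.core₂

/-- The canonical map `dom₂ → D₂`. -/
abbrev ι₂ : M.dom₂ →ₗ[ℂ] s.D₂ := toFormCompletion s.core₂

theorem norm_le_ι₂ (x : M.dom₂) : ‖(x : H₂)‖ ≤ ‖s.ι₂ x‖ := by
  refine (sq_le_sq₀ (norm_nonneg _) (norm_nonneg _)).1 ?_
  rw [norm_sq_toFormCompletion]
  exact s.upper x

variable [CompleteSpace H₂]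

/-- The embedding `I₂ : D₂ → H₂`: the continuous extension of the inclusion `dom₂ ⊆ H₂`. -/
def I₂ : s.D₂ →L[ℂ] H₂ := M.dom₂.subtype.extendOfNorm s.ι₂

theorem I₂_ι₂ (x : M.dom₂) : s.I₂ (s.ι₂ x) = x :=
  LinearMap.extendOfNorm_eq (denseRange_toFormCompletion _)
    ⟨1, fun x ↦ by simpa using s.norm_le_ι₂ x⟩ x

theorem denseRange_I₂ : DenseRange s.I₂ := by
  refine M.dense₂.mono fun x hx ↦ ⟨s.ι₂ ⟨x, hx⟩, s.I₂_ι₂ ⟨x, hx⟩⟩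

theorem inner_ι₂ (x : M.dom₂) (u : s.D₂) :
    ⟪s.ι₂ x, u⟫_ℂ = ⟪(s.τ : ℂ) • (x : H₂) - M.T₂₂ x, s.I₂ u⟫_ℂ := by
  refine (denseRange_toFormCompletion s.core₂).induction_on u
    (isClosed_eq (by fun_prop) (by fun_prop)) fun y ↦ ?_
  rw [inner_toFormCompletion, I₂_ι₂]
  rfl

theorem injective_I₂ : Function.Injective s.I₂ := by
  rw [injective_iff_map_eq_zero]
  intro u hu
  refine (denseRange_toFormCompletion s.core₂ :
    Dense (Set.range s.ι₂)).eq_zero_of_inner_right (𝕜 := ℂ) ?_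
  intro x
  exact (s.inner_ι₂ x u).trans (by rw [hu, inner_zero_right])

/-- The operator `T₂₂ : D₂ → D₂*`, the continuous extension of `I₂* T₂₂ I₂` from `dom₂`. -/
def op₂₂ : s.D₂ →L[ℂ] AntiDual s.D₂ :=
  ((dualEmb s.I₂).toLinearMap ∘ₗ M.T₂₂).extendOfNorm s.ι₂

theorem op₂₂_eq :
    s.op₂₂ = (s.τ : ℂ) • (dualEmb s.I₂ ∘L s.I₂) - innerSLFlip ℂ := by
  refine extendOfNorm_eq_of_comp (denseRange_toFormCompletion _) fun x ↦ ?_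
  refine ContinuousLinearMap.ext fun u ↦ ?_
  have h := s.inner_ι₂ x u
  rw [← inner_conj_symm, ← inner_conj_symm _ (s.I₂ u)] at h
  have h' := (starRingEnd ℂ).injective h
  simp [h', I₂_ι₂, inner_sub_right, inner_smul_right, -Complex.coe_smul]

/-- The Friedrichs extension `T₂₂^•` of `T₂₂`. -/
def friedrichs₂₂ : H₂ →ₗ.[ℂ] H₂ := bullet s.I₂ s.op₂₂

/-- The operator `(τ - T₂₂^•)⁻¹`, written as `I₂ I₂†`, where `I₂† : H₂ → D₂` is the Hilbert space
adjoint; see `isResolventAt_neg_inv₂₂`. -/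
def inv₂₂ : H₂ →L[ℂ] H₂ := s.I₂ ∘L ContinuousLinearMap.adjoint s.I₂

theorem friedrichs₂₂_graph : s.friedrichs₂₂.graph = bulletGraph s.I₂ s.op₂₂ :=
  bullet_graph s.injective_I₂ s.denseRange_I₂ _

theorem isResolventAt_neg_inv₂₂ : IsResolventAt s.friedrichs₂₂ s.τ (-s.inv₂₂) := by
  have key : ∀ y : H₂, (s.inv₂₂ y, (s.τ : ℂ) • s.inv₂₂ y - y) ∈ s.friedrichs₂₂.graph := by
    intro y
    rw [friedrichs₂₂_graph]
    refine ⟨ContinuousLinearMap.adjoint s.I₂ y, rfl, ?_⟩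
    rw [op₂₂_eq]
    refine ContinuousLinearMap.ext fun u ↦ ?_
    simp [inv₂₂, ContinuousLinearMap.adjoint_inner_right]
  refine ⟨fun x ↦ ?_, fun y ↦ ?_⟩
  · have hx := s.friedrichs₂₂.mem_graph x
    have h0 := s.friedrichs₂₂.graph.sub_mem hx (key ((s.τ : ℂ) • (x : H₂) - s.friedrichs₂₂ x))
    rw [friedrichs₂₂_graph] at h0
    obtain ⟨u, hu, hu'⟩ := h0
    have hz : u = 0 := by
      rw [op₂₂_eq] at hu'
      have h1 := DFunLike.congr_fun hu' u
      simp only [Prod.fst_sub] at hu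
      have h2 : s.friedrichs₂₂ x - ((s.τ : ℂ) • s.inv₂₂ ((s.τ : ℂ) • (x : H₂) -
          s.friedrichs₂₂ x) - ((s.τ : ℂ) • (x : H₂) - s.friedrichs₂₂ x)) =
          (s.τ : ℂ) • s.I₂ u := by
        rw [hu, smul_sub]; abel
      simp only [Prod.snd_sub] at h1
      rw [h2] at h1
      simpa [inner_smul_right] using h1
    rw [hz, map_zero] at hu
    have h3 : s.inv₂₂ ((s.τ : ℂ) • (x : H₂) - s.friedrichs₂₂ x) = x := (sub_eq_zero.1 hu.symm).symm
    rw [← neg_sub, map_neg, neg_apply, neg_neg, h3]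
  · obtain ⟨a, ha, hb⟩ := (LinearPMap.mem_graph_iff _).1 (s.friedrichs₂₂.graph.neg_mem (key y))
    have ha' : (a : H₂) = (-s.inv₂₂) y := ha
    refine ⟨ha' ▸ a.2, ?_⟩
    have hc : (⟨(-s.inv₂₂) y, ha' ▸ a.2⟩ : s.friedrichs₂₂.domain) = a := Subtype.ext ha'.symm
    rw [hc, hb]
    simp

theorem inner_inv₂₂ (x y : H₂) : ⟪s.inv₂₂ x, y⟫_ℂ =
    ⟪ContinuousLinearMap.adjoint s.I₂ x, ContinuousLinearMap.adjoint s.I₂ y⟫_ℂ := by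
  rw [ContinuousLinearMap.adjoint_inner_right]
  rfl

/-- The inner product `⟨(T₁₁ - κ) x, y⟩ + ⟨(τ - T₂₂^•)⁻¹ T₂₁ x, T₂₁ y⟩` on `dom₁`. -/
@[reducible]
def core₁ : InnerProductSpace.Core ℂ M.dom₁ where
  inner x y := ⟪M.T₁₁ x - (s.κ : ℂ) • (x : H₁), (y : H₁)⟫_ℂ + ⟪s.inv₂₂ (M.T₂₁ x), M.T₂₁ y⟫_ℂ
  conj_inner_symm x y := by
    simp only [inner_inv₂₂, inner_sub_left, inner_smul_left, map_add, map_sub, map_mul,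
      inner_conj_symm, Complex.conj_ofReal]
    rw [M.symm₁₁ x y]
  re_inner_nonneg x := by
    rw [inner_inv₂₂, map_add]
    exact add_nonneg ((sq_nonneg _).trans (s.lower x)) inner_self_nonneg
  add_left x y z := by
    simp only [Submodule.coe_add, map_add, smul_add, inner_sub_left, inner_add_left]
    ring
  smul_left x y r := by
    simp only [Submodule.coe_smul, map_smul, inner_sub_left, inner_smul_left]
    ring
  definite x hx := by
    have h := s.lower x
    have h' := inner_self_nonneg (𝕜 := ℂ) (x := ContinuousLinearMap.adjoint s.I₂ (M.T₂₁ x))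
    rw [← inner_inv₂₂] at h'
    have h0 := congrArg Complex.re hx
    rw [Complex.add_re, Complex.zero_re] at h0
    have h1 : 0 ≤ (⟪s.inv₂₂ (M.T₂₁ x), M.T₂₁ x⟫_ℂ).re := h'
    have : ‖(x : H₁)‖ = 0 := by
      have := sq_nonneg ‖(x : H₁)‖
      exact pow_eq_zero_iff two_ne_zero |>.1 (le_antisymm (by linarith) this)
    exact Subtype.ext (norm_eq_zero.1 this)

/-- The Hilbert space `D₁`: the completion of `dom₁` in the norm
`(⟨(T₁₁ - κ) y, y⟩ + ⟨(τ - T₂₂^•)⁻¹ T₂₁ y, T₂₁ y⟩) ^ (1/2)`. -/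
abbrev D₁ : Type _ := FormCompletion s.core₁

/-- The canonical map `dom₁ → D₁`. -/
abbrev ι₁ : M.dom₁ →ₗ[ℂ] s.D₁ := toFormCompletion s.core₁

theorem norm_sq_ι₁ (x : M.dom₁) : ‖s.ι₁ x‖ ^ 2 =
    (⟪M.T₁₁ x - (s.κ : ℂ) • (x : H₁), (x : H₁)⟫_ℂ).re +
      ‖ContinuousLinearMap.adjoint s.I₂ (M.T₂₁ x)‖ ^ 2 := by
  rw [norm_sq_toFormCompletion, ← inner_self_eq_norm_sq (𝕜 := ℂ), ← inner_inv₂₂]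
  exact Complex.add_re _ _

theorem norm_le_ι₁ (x : M.dom₁) : ‖(x : H₁)‖ ≤ ‖s.ι₁ x‖ := by
  refine (sq_le_sq₀ (norm_nonneg _) (norm_nonneg _)).1 ?_
  rw [norm_sq_ι₁]
  exact (s.lower x).trans (le_add_of_nonneg_right (sq_nonneg _))

/-- Auxiliary: the continuous extension `D₁ → D₂` of `I₂† T₂₁`. -/
def aux₂₁ : s.D₁ →L[ℂ] s.D₂ :=
  ((ContinuousLinearMap.adjoint s.I₂).toLinearMap ∘ₗ M.T₂₁).extendOfNorm s.ι₁

theorem aux₂₁_ι₁ (x : M.dom₁) :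
    s.aux₂₁ (s.ι₁ x) = ContinuousLinearMap.adjoint s.I₂ (M.T₂₁ x) := by
  refine LinearMap.extendOfNorm_eq (denseRange_toFormCompletion _) ⟨1, fun x ↦ ?_⟩ x
  rw [one_mul]
  refine (sq_le_sq₀ (norm_nonneg _) (norm_nonneg _)).1 ?_
  rw [norm_sq_ι₁]
  exact le_add_of_nonneg_left ((sq_nonneg _).trans (s.lower x))

variable [CompleteSpace H₁]

/-- The embedding `I₁ : D₁ → H₁`: the continuous extension of the inclusion `dom₁ ⊆ H₁`. -/
def I₁ : s.D₁ →L[ℂ] H₁ := M.dom₁.subtype.extendOfNorm s.ι₁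

theorem I₁_ι₁ (x : M.dom₁) : s.I₁ (s.ι₁ x) = x :=
  LinearMap.extendOfNorm_eq (denseRange_toFormCompletion _)
    ⟨1, fun x ↦ by simpa using s.norm_le_ι₁ x⟩ x

theorem denseRange_I₁ : DenseRange s.I₁ := by
  refine M.dense₁.mono fun x hx ↦ ⟨s.ι₁ ⟨x, hx⟩, s.I₁_ι₁ ⟨x, hx⟩⟩

theorem inner_ι₁ (x : M.dom₁) (u : s.D₁) : ⟪s.ι₁ x, u⟫_ℂ =
    ⟪M.T₁₁ x - (s.κ : ℂ) • (x : H₁), s.I₁ u⟫_ℂ + ⟪s.aux₂₁ (s.ι₁ x), s.aux₂₁ u⟫_ℂ := by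
  refine (denseRange_toFormCompletion s.core₁).induction_on u
    (isClosed_eq (by fun_prop) (by fun_prop)) fun y ↦ ?_
  rw [inner_toFormCompletion, I₁_ι₁, aux₂₁_ι₁, aux₂₁_ι₁, ← inner_inv₂₂]
  rfl

theorem inner_ι₂_aux₂₁ (x : M.dom₂) (u : s.D₁) :
    ⟪s.ι₂ x, s.aux₂₁ u⟫_ℂ = ⟪M.T₁₂ x, s.I₁ u⟫_ℂ := by
  refine (denseRange_toFormCompletion s.core₁).induction_on u
    (isClosed_eq (by fun_prop) (by fun_prop)) fun y ↦ ?_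
  rw [I₁_ι₁, aux₂₁_ι₁, ContinuousLinearMap.adjoint_inner_right, I₂_ι₂, M.symm₁₂]

theorem injective_I₁ : Function.Injective s.I₁ := by
  rw [injective_iff_map_eq_zero]
  intro u hu
  have h0 : s.aux₂₁ u = 0 := by
    refine (denseRange_toFormCompletion s.core₂ :
      Dense (Set.range s.ι₂)).eq_zero_of_inner_right (𝕜 := ℂ) ?_
    intro x
    exact (s.inner_ι₂_aux₂₁ x u).trans (by rw [hu, inner_zero_right])
  refine (denseRange_toFormCompletion s.core₁ :
    Dense (Set.range s.ι₁)).eq_zero_of_inner_right (𝕜 := ℂ) ?_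
  intro x
  exact (s.inner_ι₁ x u).trans (by rw [hu, h0, inner_zero_right, inner_zero_right, add_zero])

/-- The operator `T₁₁ : D₁ → D₁*`, the continuous extension of `I₁* T₁₁ I₁`. -/
def op₁₁ : s.D₁ →L[ℂ] AntiDual s.D₁ :=
  ((dualEmb s.I₁).toLinearMap ∘ₗ M.T₁₁).extendOfNorm s.ι₁

theorem op₁₁_eq : s.op₁₁ = (s.κ : ℂ) • (dualEmb s.I₁ ∘L s.I₁) + innerSLFlip ℂ -
    ContinuousLinearMap.precomp ℂ s.aux₂₁ ∘L innerSLFlip ℂ ∘L s.aux₂₁ := by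
  refine extendOfNorm_eq_of_comp (denseRange_toFormCompletion _) fun x ↦ ?_
  refine ContinuousLinearMap.ext fun u ↦ ?_
  have h := congrArg (starRingEnd ℂ) (s.inner_ι₁ x u)
  rw [map_add] at h
  simp only [inner_conj_symm] at h
  simp [h, I₁_ι₁, inner_sub_right, inner_smul_right, -Complex.coe_smul]
  ring

/-- The operator `T₂₁ : D₁ → D₂*`, the continuous extension of `I₂* T₂₁ I₁`. -/
def op₂₁ : s.D₁ →L[ℂ] AntiDual s.D₂ :=
  ((dualEmb s.I₂).toLinearMap ∘ₗ M.T₂₁).extendOfNorm s.ι₁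

theorem op₂₁_eq : s.op₂₁ = innerSLFlip ℂ ∘L s.aux₂₁ := by
  refine extendOfNorm_eq_of_comp (denseRange_toFormCompletion _) fun x ↦ ?_
  refine ContinuousLinearMap.ext fun u ↦ ?_
  simp [aux₂₁_ι₁, ContinuousLinearMap.adjoint_inner_right]

/-- The operator `T₁₂ : D₂ → D₁*`, the continuous extension of `I₁* T₁₂ I₂`. -/
def op₁₂ : s.D₂ →L[ℂ] AntiDual s.D₁ :=
  ((dualEmb s.I₁).toLinearMap ∘ₗ M.T₁₂).extendOfNorm s.ι₂

theorem op₁₂_eq : s.op₁₂ = ContinuousLinearMap.precomp ℂ s.aux₂₁ ∘L innerSLFlip ℂ := by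
  refine extendOfNorm_eq_of_comp (denseRange_toFormCompletion _) fun x ↦ ?_
  refine ContinuousLinearMap.ext fun u ↦ ?_
  have h := congrArg (starRingEnd ℂ) (s.inner_ι₂_aux₂₁ x u)
  simp only [inner_conj_symm] at h
  simpa using h

/-- The Hilbert space `D = D₁ ⊕ D₂`. -/
abbrev D : Type _ := WithLp 2 (s.D₁ × s.D₂)

/-- The embedding `I = I₁ ⊕ I₂ : D → H₁ ⊕ H₂`. -/
def I : s.D →L[ℂ] WithLp 2 (H₁ × H₂) :=
  (WithLp.prodContinuousLinearEquiv 2 ℂ H₁ H₂).symm.toContinuousLinearMap ∘L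
    (s.I₁.prodMap s.I₂) ∘L (WithLp.prodContinuousLinearEquiv 2 ℂ s.D₁ s.D₂).toContinuousLinearMap

/-- The operator `T : D → D*` with the entries `Tᵢⱼ`; see `op_apply`. -/
def op : s.D →L[ℂ] AntiDual s.D :=
  ContinuousLinearMap.precomp ℂ (WithLp.fstL 2 ℂ s.D₁ s.D₂) ∘L
      (s.op₁₁ ∘L WithLp.fstL 2 ℂ s.D₁ s.D₂ + s.op₁₂ ∘L WithLp.sndL 2 ℂ s.D₁ s.D₂) +
    ContinuousLinearMap.precomp ℂ (WithLp.sndL 2 ℂ s.D₁ s.D₂) ∘L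
      (s.op₂₁ ∘L WithLp.fstL 2 ℂ s.D₁ s.D₂ + s.op₂₂ ∘L WithLp.sndL 2 ℂ s.D₁ s.D₂)

theorem op_apply (x y : s.D) :
    s.op x y = (s.op₁₁ x.fst y.fst + s.op₁₂ x.snd y.fst) +
      (s.op₂₁ x.fst y.snd + s.op₂₂ x.snd y.snd) := rfl

theorem I_apply (x : s.D) : s.I x = WithLp.toLp 2 (s.I₁ x.fst, s.I₂ x.snd) := rfl

/-- The angular extension `T^• = (I*)⁻¹ T I⁻¹` of the operator matrix. -/
def angularExtension : WithLp 2 (H₁ × H₂) →ₗ.[ℂ] WithLp 2 (H₁ × H₂) := bullet s.I s.op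

theorem injective_I : Function.Injective s.I := by
  rw [injective_iff_map_eq_zero]
  intro x hx
  have h1 : s.I₁ x.fst = 0 := congrArg WithLp.fst hx
  have h2 : s.I₂ x.snd = 0 := congrArg WithLp.snd hx
  have h1' := (injective_iff_map_eq_zero s.I₁).1 s.injective_I₁ _ h1
  have h2' := (injective_iff_map_eq_zero s.I₂).1 s.injective_I₂ _ h2
  exact WithLp.ofLp_injective 2 (Prod.ext h1' h2')

theorem denseRange_I : DenseRange s.I :=
  (WithLp.prodContinuousLinearEquiv 2 ℂ H₁ H₂).symm.surjective.denseRange.comp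
    ((s.denseRange_I₁.prodMap s.denseRange_I₂).comp
      (WithLp.prodContinuousLinearEquiv 2 ℂ s.D₁ s.D₂).surjective.denseRange
      (s.I₁.prodMap s.I₂).continuous)
    (WithLp.prodContinuousLinearEquiv 2 ℂ H₁ H₂).symm.continuous

theorem angularExtension_graph : s.angularExtension.graph = bulletGraph s.I s.op :=
  bullet_graph s.injective_I s.denseRange_I _

/-- The pencil `T₂₂ - z I₂* I₂ : D₂ → D₂*`. -/
def pencil₂₂ (z : ℂ) : s.D₂ →L[ℂ] AntiDual s.D₂ := s.op₂₂ - z • (dualEmb s.I₂ ∘L s.I₂)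

/-- The transfer function `S(z) = T₁₁ - z I₁* I₁ - T₁₂ (T₂₂ - z I₂* I₂)⁻¹ T₂₁ : D₁ → D₁*`. -/
def transfer (z : ℂ) : s.D₁ →L[ℂ] AntiDual s.D₁ :=
  s.op₁₁ - z • (dualEmb s.I₁ ∘L s.I₁) - s.op₁₂ ∘L (s.pencil₂₂ z).inverse ∘L s.op₂₁

end Shifts

end SymmBlockMatrix

end

/-! ### Negative index of Hermitian forms: comparison, attainment, additivity. -/

section Rank

variable {V W : Type*} [AddCommGroup V] [Module ℂ V] [AddCommGroup W] [Module ℂ W]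

/-! Let R = (T^• − ζ)⁻¹, a bounded self-adjoint operator. The heart of the proof is the identity ind
S(x) = ind S(ζ) + ind((x − ζ)⁻¹ − R) for x > ζ (`negIndex_transfer`). Both sides compute the index
of one Hermitian form on D₁ ⊕ H with entries S(ζ), J, J*, Q, where J u = (I₁ u, −I₂ (T₂₂ − ζ I₂*
I₂)⁻¹ T₂₁ u) and Q = (x − ζ)⁻¹ + 0 ⊕ (ζ − T₂₂^•)⁻¹. Eliminating H leaves S(x). Eliminating D₁ leaves
(x − ζ)⁻¹ − R, because R = J S(ζ)⁻¹ J* − 0 ⊕ (ζ − T₂₂^•)⁻¹ by the Frobenius–Schur factorization. As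
T₂₂^• is bounded above and has no spectrum in [ζ, +∞), Q is nonnegative and contributes no index, so
the identity is Haynsworth's inertia additivity (`negIndex_schur`).

The rest is spectral theory of R. The index of t − R counts the eigenvalues of R above t
(`formIndex_eq_encard`). With t = (x − ζ)⁻¹ and the substitution r = (λ − ζ)⁻¹ these are the
eigenvalues of T^• in (ζ, x), as long as no essential spectrum lies there; once x exceeds λ_e the
index is infinite. So λ_n is where the index starts to exceed n (`IsResolventAt.nthLevel_eq_sInf`),
and the finite number ind S(ζ) cancels. -/

theorem toENat_rank_le_of_injective (f : V →ₗ[ℂ] W) (hf : Function.Injective f) :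
    Cardinal.toENat (Module.rank ℂ V) ≤ Cardinal.toENat (Module.rank ℂ W) := by
  rw [← Cardinal.toENat_lift, ← Cardinal.toENat_lift (c := Module.rank ℂ W)]
  exact OrderHomClass.mono _ (LinearMap.lift_rank_le_of_injective f hf)

theorem toENat_rank_prod :
    Cardinal.toENat (Module.rank ℂ (V × W)) =
      Cardinal.toENat (Module.rank ℂ V) + Cardinal.toENat (Module.rank ℂ W) := by
  rw [rank_prod, map_add, Cardinal.toENat_lift, Cardinal.toENat_lift]

/-- The supremum of the dimensions of the subspaces on which the function `q` is negative. -/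
noncomputable def formIndex (q : V → ℝ) : ℕ∞ :=
  ⨆ (L : Submodule ℂ V) (_ : ∀ y ∈ L, y ≠ 0 → q y < 0), Cardinal.toENat (Module.rank ℂ L)

theorem toENat_rank_le_formIndex {q : V → ℝ} {L : Submodule ℂ V}
    (hL : ∀ y ∈ L, y ≠ 0 → q y < 0) : Cardinal.toENat (Module.rank ℂ L) ≤ formIndex q :=
  le_iSup₂_of_le L hL le_rfl

/-- The map `f` need not be injective: it cannot kill a vector where `q` is negative, since `q'`
vanishes at 0, so it is injective on every negative subspace. -/
theorem formIndex_le_of_map {q : V → ℝ} {q' : W → ℝ} (f : V →ₗ[ℂ] W)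
    (h : ∀ x, q x < 0 → q' (f x) < 0) (h0 : q' 0 = 0) : formIndex q ≤ formIndex q' := by
  refine iSup₂_le fun L hL ↦ ?_
  refine le_trans ?_ (toENat_rank_le_formIndex (L := L.map f) ?_)
  · refine toENat_rank_le_of_injective (f.submoduleMap L) ?_
    rw [injective_iff_map_eq_zero]
    intro x hx
    by_contra hne
    have h1 := h x (hL x x.2 (by simpa using hne))
    have h2 : f x = 0 := congrArg Subtype.val hx
    rw [h2, h0] at h1
    exact lt_irrefl _ h1
  · rintro _ ⟨x, hx, rfl⟩ hne
    exact h x (hL x hx fun h ↦ hne (by rw [h, map_zero]))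

/-- A negative subspace meets the kernel of `f` only in 0. This is the source of all upper bounds
for the index. -/
theorem formIndex_le_of_ker {q : V → ℝ} (f : V →ₗ[ℂ] W) (h : ∀ x, f x = 0 → 0 ≤ q x) :
    formIndex q ≤ Cardinal.toENat (Module.rank ℂ W) := by
  refine iSup₂_le fun L hL ↦ toENat_rank_le_of_injective (f ∘ₗ L.subtype) ?_
  rw [injective_iff_map_eq_zero]
  intro x hx
  by_contra hne
  exact absurd (hL x x.2 (by simpa using hne)) (not_lt.2 (h x hx))

theorem formIndex_attained {q : V → ℝ} (hq : formIndex q < ⊤) :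
    ∃ L : Submodule ℂ V, (∀ y ∈ L, y ≠ 0 → q y < 0) ∧
      Cardinal.toENat (Module.rank ℂ L) = formIndex q := by
  unfold formIndex at hq ⊢
  rw [iSup_subtype'] at hq ⊢
  have : Nonempty {L : Submodule ℂ V // ∀ y ∈ L, y ≠ 0 → q y < 0} :=
    ⟨⟨⊥, fun y hy hne ↦ absurd hy hne⟩⟩
  obtain ⟨L, hL⟩ := ENat.exists_eq_iSup_of_lt_top hq
  exact ⟨L, L.2, hL⟩

theorem finiteDimensional_of_toENat_rank_lt_top
    (h : Cardinal.toENat (Module.rank ℂ V) < ⊤) : FiniteDimensional ℂ V := by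
  rw [Cardinal.toENat_lt_top] at h
  exact Module.rank_lt_aleph0_iff.1 h

theorem toENat_rank_eq_finrank [FiniteDimensional ℂ V] :
    Cardinal.toENat (Module.rank ℂ V) = Module.finrank ℂ V := by
  rw [← Module.finrank_eq_rank, Cardinal.toENat_nat]

/-- A Hermitian form of finite negative index `k` is nonnegative on the kernel of a linear map into
`ℂ ^ k`. -/
theorem exists_nonneg_on_ker (B : V →ₗ[ℂ] V →ₗ⋆[ℂ] ℂ) (hB : ∀ x y, B y x = conj (B x y)) {k : ℕ}
    (hk : formIndex (fun x ↦ (B x x).re) = k) :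
    ∃ p : V →ₗ[ℂ] (Fin k → ℂ), ∀ x, p x = 0 → 0 ≤ (B x x).re := by
  obtain ⟨L, hL, hLk⟩ := formIndex_attained (hk.trans_lt (ENat.natCast_lt_top k))
  rw [hk] at hLk
  have := finiteDimensional_of_toENat_rank_lt_top (hLk.trans_lt (ENat.natCast_lt_top k))
  rw [toENat_rank_eq_finrank, Nat.cast_inj] at hLk
  let b := Module.finBasisOfFinrankEq ℂ L hLk
  have hfl : ∀ y : V, ∃ f : V →ₗ[ℂ] ℂ, ∀ x, f x = B x y := fun y ↦
    ⟨{ toFun := fun x ↦ B x y, map_add' := by simp, map_smul' := by simp }, fun x ↦ rfl⟩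
  choose f hf using hfl
  -- The kernel of this map is the `B`-orthogonal complement of a negative subspace `L` of maximal
  -- dimension.
  refine ⟨LinearMap.pi fun i ↦ f (b i), fun x hx ↦ ?_⟩
  have hx0 : ∀ y ∈ L, B x y = 0 := by
    intro y hy
    have h1 : ∀ i, B x (b i) = 0 := fun i ↦ (hf _ _).symm.trans (congrFun hx i)
    have h2 : (∑ i, b.repr ⟨y, hy⟩ i • (b i : V)) = y := by
      have h3 := congrArg L.subtype (b.sum_repr ⟨y, hy⟩)
      rwa [map_sum] at h3
    rw [← h2, map_sum]
    simp [h1]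
  -- A vector orthogonal to `L` with negative square could be added to `L`, giving a negative
  -- subspace of dimension `k + 1`.
  by_contra hneg
  push Not at hneg
  have hxL : x ∉ L := fun h ↦ by
    rw [hx0 x h] at hneg
    exact lt_irrefl _ hneg
  have hne : ∀ z ∈ L ⊔ ℂ ∙ x, z ≠ 0 → (B z z).re < 0 := by
    intro z hz hz0
    obtain ⟨y, hy, w, hw, rfl⟩ := Submodule.mem_sup.1 hz
    obtain ⟨a, rfl⟩ := Submodule.mem_span_singleton.1 hw
    have h1 : (B (y + a • x) (y + a • x)).re = (B y y).re + ‖a‖ ^ 2 * (B x x).re := by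
      have : B y x = 0 := by rw [hB, hx0 y hy, map_zero]
      simp only [map_add, map_smul, LinearMap.add_apply, LinearMap.smul_apply,
        LinearMap.map_smulₛₗ, hx0 y hy, this, smul_eq_mul, mul_zero, add_zero, zero_add,
        Complex.add_re]
      rw [← mul_assoc, mul_comm _ a, Complex.mul_conj, Complex.re_ofReal_mul,
        Complex.normSq_eq_norm_sq]
    rw [h1]
    by_cases ha : a = 0
    · subst ha
      simp only [zero_smul, add_zero] at hz0
      simpa using hL y hy hz0
    · have h2 : ‖a‖ ^ 2 * (B x x).re < 0 := mul_neg_of_pos_of_neg (by positivity) hneg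
      have h3 : (B y y).re ≤ 0 := by
        by_cases hy0 : y = 0
        · simp [hy0]
        · exact (hL y hy hy0).le
      linarith
  have h1 := toENat_rank_le_formIndex hne
  rw [hk, toENat_rank_eq_finrank, Nat.cast_le] at h1
  have h2 : L < L ⊔ ℂ ∙ x := lt_of_le_of_ne le_sup_left fun h ↦
    hxL (h ▸ (le_sup_right : _ ≤ L ⊔ ℂ ∙ x) (Submodule.mem_span_singleton_self x))
  have h3 := Submodule.finrank_lt_finrank_of_lt h2
  omega

/-- Products of negative subspaces give the lower bound. For the upper bound the sum is nonnegative
on the kernel of a map into ℂ^k × ℂ^m. Infinite indices are settled beforehand, since that map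
exists only for finite ones. -/
theorem formIndex_prod (B : V →ₗ[ℂ] V →ₗ⋆[ℂ] ℂ) (hB : ∀ x y, B y x = conj (B x y))
    (C : W →ₗ[ℂ] W →ₗ⋆[ℂ] ℂ) (hC : ∀ x y, C y x = conj (C x y)) :
    formIndex (fun x : V × W ↦ (B x.1 x.1).re + (C x.2 x.2).re) =
      formIndex (fun x ↦ (B x x).re) + formIndex (fun x ↦ (C x x).re) := by
  have hB' : formIndex (fun x ↦ (B x x).re) ≤
      formIndex (fun x : V × W ↦ (B x.1 x.1).re + (C x.2 x.2).re) :=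
    formIndex_le_of_map (LinearMap.inl ℂ V W) (by simp) (by simp)
  have hC' : formIndex (fun x ↦ (C x x).re) ≤
      formIndex (fun x : V × W ↦ (B x.1 x.1).re + (C x.2 x.2).re) :=
    formIndex_le_of_map (LinearMap.inr ℂ V W) (by simp) (by simp)
  by_cases h1 : formIndex (fun x ↦ (B x x).re) = ⊤
  · rw [h1, top_le_iff] at hB'
    rw [hB', h1, top_add]
  by_cases h2 : formIndex (fun x ↦ (C x x).re) = ⊤
  · rw [h2, top_le_iff] at hC'
    rw [hC', h2, add_top]
  refine le_antisymm ?_ ?_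
  · obtain ⟨k, hk⟩ := ENat.ne_top_iff_exists.1 h1
    obtain ⟨m, hm⟩ := ENat.ne_top_iff_exists.1 h2
    obtain ⟨p, hp⟩ := exists_nonneg_on_ker B hB hk.symm
    obtain ⟨r, hr⟩ := exists_nonneg_on_ker C hC hm.symm
    refine (formIndex_le_of_ker (p.prodMap r) fun x hx ↦ ?_).trans ?_
    · exact add_nonneg (hp _ (congrArg Prod.fst hx)) (hr _ (congrArg Prod.snd hx))
    · rw [toENat_rank_prod, ← hk, ← hm]
      simp
  · obtain ⟨L, hL, hL'⟩ := formIndex_attained (lt_top_iff_ne_top.2 h1)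
    obtain ⟨N, hN, hN'⟩ := formIndex_attained (lt_top_iff_ne_top.2 h2)
    rw [← hL', ← hN', ← toENat_rank_prod]
    refine le_trans ?_ (toENat_rank_le_formIndex (L := L.prod N) ?_)
    · refine toENat_rank_le_of_injective
        (LinearMap.codRestrict (L.prod N) (L.subtype.prodMap N.subtype)
          fun x ↦ ⟨x.1.2, x.2.2⟩) ?_
      rintro ⟨x, y⟩ ⟨x', y'⟩ h
      have := congrArg Subtype.val h
      have h1 : (x : V) = x' := congrArg Prod.fst this
      have h2 : (y : W) = y' := congrArg Prod.snd this
      exact Prod.ext (Subtype.ext h1) (Subtype.ext h2)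
    · rintro ⟨x, y⟩ ⟨hx, hy⟩ hne
      have hx' : (B x x).re ≤ 0 := by
        by_cases hx0 : x = 0
        · simp [hx0]
        · exact (hL x hx hx0).le
      by_cases hy0 : y = 0
      · have : x ≠ 0 := fun h ↦ hne (by simp [h, hy0])
        simpa [hy0] using hL x hx this
      · exact add_neg_of_nonpos_of_neg hx' (hN y hy hy0)

end Rank

/-! ### Inertia of Schur complements. -/

section Schur

variable {D H : Type*} [NormedAddCommGroup D] [InnerProductSpace ℂ D]
  [NormedAddCommGroup H] [InnerProductSpace ℂ H]

/-- The underlying sesquilinear form of an operator `D → D*`. -/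
noncomputable def toSesq (A : D →L[ℂ] AntiDual D) : D →ₗ[ℂ] D →ₗ⋆[ℂ] ℂ where
  toFun x := (A x).toLinearMap
  map_add' x y := by ext; simp
  map_smul' a x := by ext; simp

/-- The Haynsworth inertia formula for the two Schur complements `S' = S - J* Q⁻¹ J` and
`E = Q - J S⁻¹ J*` of the entries of a block form. Here `K = Q⁻¹ J` and `Y = S⁻¹ J*`. -/
theorem negIndex_schur {S S' : D →L[ℂ] AntiDual D} {E : H →L[ℂ] H} {Q : H →ₗ[ℂ] H}
    (J K : D →ₗ[ℂ] H) (Y : H →ₗ[ℂ] D) (hS : ∀ x y, S y x = conj (S x y))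
    (hE : ∀ x y, ⟪E x, y⟫_ℂ = ⟪x, E y⟫_ℂ) (hQ : ∀ x y, ⟪Q x, y⟫_ℂ = ⟪x, Q y⟫_ℂ)
    (hQ0 : ∀ x, 0 ≤ (⟪x, Q x⟫_ℂ).re) (hY : ∀ h v, S (Y h) v = ⟪J v, h⟫_ℂ)
    (hEQ : ∀ h, E h = Q h - J (Y h)) (hK : ∀ u, Q (K u) = J u)
    (hS' : ∀ u, S' u u = S u u - ⟪J u, K u⟫_ℂ) :
    negIndex S' = negIndex S + formIndex fun h ↦ (⟪h, E h⟫_ℂ).re := by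
  -- Both sides are the block form S(u, u) + 2 Re⟨J u, h⟩ + ⟨h, Q h⟩ at u = v − Y h, with the square
  -- completed in u on the left and in h on the right.
  have key : ∀ v h, (S v v).re + (⟪h, E h⟫_ℂ).re =
      (S' (v - Y h) (v - Y h)).re +
        (⟪h + K (v - Y h), Q (h + K (v - Y h))⟫_ℂ).re := by
    intro v h
    obtain ⟨u, rfl⟩ : ∃ u, v = u + Y h := ⟨v - Y h, by abel⟩
    rw [add_sub_cancel_right]
    have e1 : (⟪h, J u⟫_ℂ).re = (⟪J u, h⟫_ℂ).re := by
      rw [← inner_conj_symm, Complex.conj_re]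
    have e2 : (⟪h, J (Y h)⟫_ℂ).re = (⟪J (Y h), h⟫_ℂ).re := by
      rw [← inner_conj_symm, Complex.conj_re]
    have e3 : (S u (Y h)).re = (⟪J u, h⟫_ℂ).re := by
      rw [hS, hY, Complex.conj_re]
    have e4 : (⟪K u, J u⟫_ℂ).re = (⟪J u, K u⟫_ℂ).re := by
      rw [← inner_conj_symm, Complex.conj_re]
    have e5 : ⟪K u, Q h⟫_ℂ = ⟪J u, h⟫_ℂ := by rw [← hQ, hK]
    simp only [map_add, add_apply, inner_add_left, inner_add_right, hEQ, hK,
      inner_sub_right, Complex.add_re, Complex.sub_re, hS', e1, e2, e3, e4, e5, hY]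
    ring
  have h1 : formIndex (fun x : D × H ↦ (S x.1 x.1).re + (⟪x.2, E x.2⟫_ℂ).re) =
      negIndex S + formIndex fun h ↦ (⟪h, E h⟫_ℂ).re := by
    refine formIndex_prod (toSesq S) hS (toSesq (innerSLFlip ℂ ∘L E)) fun x y ↦ ?_
    change ⟪x, E y⟫_ℂ = conj ⟪y, E x⟫_ℂ
    rw [inner_conj_symm, hE]
  rw [← h1]
  refine le_antisymm ?_ ?_
  -- The choice h = −K u, v = u + Y h makes the `Q`-square vanish and leaves S'(u, u).
  · refine formIndex_le_of_map ((LinearMap.id - Y ∘ₗ K).prod (-K)) (fun u hu ↦ ?_) (by simp)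
    refine lt_of_le_of_lt (le_of_eq ?_) hu
    change (S (u - Y (K u)) (u - Y (K u))).re + (⟪- K u, E (- K u)⟫_ℂ).re = _
    rw [key]
    simp
  -- Conversely, dropping the nonnegative `Q`-square can only decrease the form.
  · refine formIndex_le_of_map ((LinearMap.id : D →ₗ[ℂ] D).coprod (-Y)) (fun x hx ↦ ?_) (by simp)
    change (S' (x.1 + - Y x.2) (x.1 + - Y x.2)).re < 0
    rw [key] at hx
    rw [← sub_eq_add_neg]
    have := hQ0 (x.2 + K (x.1 - Y x.2))
    linarith

end Schur

/-! ### The index of t − R and the eigenvalues of R above t. -/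

section SelfAdjoint

open Filter Topology

variable {H : Type*} [NormedAddCommGroup H] [InnerProductSpace ℂ H] [CompleteSpace H]
  {R : H →L[ℂ] H}

theorem re_inner_cfc_nonneg {f : ℝ → ℝ} (hf : ∀ x ∈ spectrum ℝ R, 0 ≤ f x) (y : H) :
    0 ≤ (⟪y, cfc f R y⟫_ℂ).re := by
  have h : 0 ≤ cfc f R := cfc_nonneg hf
  rw [ContinuousLinearMap.nonneg_iff_isPositive] at h
  exact h.re_inner_nonneg_right y

theorem cfc_eq_sub_smul (hR : IsSelfAdjoint R) (t : ℝ) (y : H) :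
    cfc (fun x : ℝ ↦ x - t) R y = R y - t • y := by
  rw [cfc_sub (fun x : ℝ ↦ x) (fun _ ↦ t) R, cfc_id' ℝ R, cfc_const t R]
  simp [Algebra.algebraMap_eq_smul_one]

theorem re_inner_cfc_sub (hR : IsSelfAdjoint R) (t : ℝ) (y : H) :
    (⟪y, cfc (fun x : ℝ ↦ x - t) R y⟫_ℂ).re = (⟪y, R y⟫_ℂ).re - t * ‖y‖ ^ 2 := by
  rw [cfc_eq_sub_smul hR, inner_sub_right, inner_smul_right_eq_smul, Complex.sub_re,
    inner_self_eq_norm_sq_to_K]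
  simp [← Complex.ofReal_pow]

/-- On the kernel of the positive part (R − t)₊ the operator t − R acts as the negative part of R −
t. -/
theorem nonneg_of_cfc_max_apply_eq_zero (hR : IsSelfAdjoint R) {t : ℝ} {y : H}
    (hy : cfc (fun x : ℝ ↦ max (x - t) 0) R y = 0) : 0 ≤ t * ‖y‖ ^ 2 - (⟪y, R y⟫_ℂ).re := by
  have h := re_inner_cfc_nonneg (R := R) (f := fun x ↦ max (x - t) 0 - (x - t))
    (fun x _ ↦ sub_nonneg.2 (le_max_left _ _)) y
  rw [cfc_sub (fun x : ℝ ↦ max (x - t) 0) (fun x ↦ x - t) R, sub_apply, hy, zero_sub,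
    inner_neg_right, Complex.neg_re, re_inner_cfc_sub hR] at h
  linarith

theorem cfc_apply_eq_zero_of_sq {f : ℝ → ℝ} {y : H}
    (h : (⟪y, cfc (fun x ↦ f x * f x) R y⟫_ℂ).re ≤ 0) (hf : ContinuousOn f (spectrum ℝ R)) : cfc f R y = 0 := by
  rw [cfc_mul f f R hf hf, mul_apply_eq_comp,
    ← (cfc_predicate f R : IsSelfAdjoint _).isSymmetric.apply_clm] at h
  have h1 : ‖cfc f R y‖ ^ 2 ≤ 0 := by
    rw [← inner_self_eq_norm_sq (𝕜 := ℂ)]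
    exact h
  exact norm_eq_zero.1 (pow_eq_zero_iff two_ne_zero |>.1 (le_antisymm h1 (sq_nonneg _)))

/-- The range of f(R) with f(x) = (x − t)₊ replaces the spectral subspace for (t, ∞), whose
indicator need not be continuous on the spectrum. On this range R − t acts as f(R). If ⟨z, f(R) z⟩ ≤
0 for z = f(R) y, then √f(R) z = 0, hence f(R)² y = 0 and z = 0. -/
theorem neg_on_range_cfc_max (hR : IsSelfAdjoint R) {t : ℝ} {z : H}
    (hz : z ∈ LinearMap.range (cfc (fun x : ℝ ↦ max (x - t) 0) R).toLinearMap) (hz0 : z ≠ 0) :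
    t * ‖z‖ ^ 2 - (⟪z, R z⟫_ℂ).re < 0 := by
  obtain ⟨y, rfl⟩ := hz
  set f : ℝ → ℝ := fun x ↦ max (x - t) 0 with hf
  have hfc : Continuous f := by fun_prop
  change cfc f R y ≠ 0 at hz0
  by_contra hcon
  push Not at hcon
  change 0 ≤ t * ‖cfc f R y‖ ^ 2 - (⟪cfc f R y, R (cfc f R y)⟫_ℂ).re at hcon
  have h1 : cfc (fun x : ℝ ↦ x - t) R (cfc f R y) = cfc f R (cfc f R y) := by
    rw [← mul_apply_eq_comp, ← mul_apply_eq_comp, ← cfc_mul _ f R (by fun_prop) hfc.continuousOn,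
      ← cfc_mul f f R hfc.continuousOn hfc.continuousOn]
    congr 1
    refine cfc_congr fun x _ ↦ ?_
    rcases le_total 0 (x - t) with h | h <;> simp [hf, h]
  have hsq : cfc f R = cfc (fun x ↦ √(f x) * √(f x)) R :=
    cfc_congr fun x _ ↦ (Real.mul_self_sqrt (le_max_right _ _)).symm
  have h2 : cfc (fun x ↦ √(f x)) R (cfc f R y) = 0 := by
    refine cfc_apply_eq_zero_of_sq ?_ (by fun_prop)
    rw [← hsq, ← h1, re_inner_cfc_sub hR]
    linarith
  have h3 : cfc f R (cfc f R y) = 0 := by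
    have h4 : cfc f R = cfc (fun x ↦ √(f x)) R * cfc (fun x ↦ √(f x)) R :=
      hsq.trans (cfc_mul _ _ R (by fun_prop) (by fun_prop))
    calc cfc f R (cfc f R y)
        = (cfc (fun x ↦ √(f x)) R * cfc (fun x ↦ √(f x)) R) (cfc f R y) := by rw [← h4]
      _ = 0 := by rw [mul_apply_eq_comp, h2, map_zero]
  refine hz0 (cfc_apply_eq_zero_of_sq ?_ hfc.continuousOn)
  rw [cfc_mul f f R hfc.continuousOn hfc.continuousOn, mul_apply_eq_comp, h3, inner_zero_right,
    Complex.zero_re]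

omit [CompleteSpace H] in
-- If p is the minimal polynomial of `g` on its range, then p(X)·X annihilates `g`, so the spectrum
-- consists of roots of p(X)·X.
theorem finite_spectrum_of_finiteDimensional_range {g : H →L[ℂ] H}
    [FiniteDimensional ℂ (LinearMap.range g.toLinearMap)] : (spectrum ℂ g).Finite := by
  let W := LinearMap.range g.toLinearMap
  let gW : W →ₗ[ℂ] W := g.toLinearMap.restrict fun x _ ↦ ⟨x, rfl⟩
  have h1 : ∀ (p : Polynomial ℂ) (w : W), (Polynomial.aeval gW p w : H) =
      Polynomial.aeval g p (w : H) := by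
    intro p
    induction p using Polynomial.induction_on' with
    | add p q hp hq => intro w; simp [hp, hq]
    | monomial n a =>
      have h2 : ∀ (n : ℕ) (w : W), ((gW ^ n) w : H) = (g ^ n) (w : H) := by
        intro n
        induction n with
        | zero => simp
        | succ n ih =>
          intro w
          rw [pow_succ, pow_succ, Module.End.mul_apply, ih, mul_apply_eq_comp]
          rfl
      intro w
      simp [Polynomial.aeval_monomial, Algebra.algebraMap_eq_smul_one, h2]
  have h2 : Polynomial.aeval g (minpoly ℂ gW * Polynomial.X) = 0 := by
    ext x
    rw [map_mul, Polynomial.aeval_X, mul_apply_eq_comp, ← h1 _ ⟨g x, x, rfl⟩, minpoly.aeval]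
    rfl
  have h3 : minpoly ℂ gW * Polynomial.X ≠ 0 :=
    mul_ne_zero (minpoly.ne_zero (Algebra.IsIntegral.isIntegral gW)) Polynomial.X_ne_zero
  refine (Polynomial.finite_setOfPred_isRoot h3).subset fun z hz ↦ ?_
  have h4 := spectrum.subset_polynomial_aeval g (minpoly ℂ gW * Polynomial.X) ⟨z, hz, rfl⟩
  rw [h2] at h4
  by_contra h5
  refine h4 ?_
  rw [spectrum.mem_resolventSet_iff, sub_zero]
  exact (IsUnit.mk0 _ h5).map (algebraMap ℂ (H →L[ℂ] H))

/-- Finite index forces (R − t)₊ to have finite rank, hence finite spectrum; by spectral mapping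
this transfers to `R`, since x ↦ (x − t)₊ is injective above `t`. -/
theorem finite_spectrum_of_formIndex_lt_top (hR : IsSelfAdjoint R) {t : ℝ}
    (h : formIndex (fun y ↦ t * ‖y‖ ^ 2 - (⟪y, R y⟫_ℂ).re) < ⊤) :
    (spectrum ℝ R ∩ Set.Ioi t).Finite := by
  have h1 := (toENat_rank_le_formIndex fun z ↦ neg_on_range_cfc_max hR (t := t)).trans_lt h
  have := finiteDimensional_of_toENat_rank_lt_top h1
  have h2 := finite_spectrum_of_finiteDimensional_range (g := cfc (fun x : ℝ ↦ max (x - t) 0) R)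
  have h3 : (spectrum ℝ (cfc (fun x : ℝ ↦ max (x - t) 0) R)).Finite := by
    refine Set.Finite.of_finite_image (f := ((↑) : ℝ → ℂ)) (h2.subset ?_)
      Complex.ofReal_injective.injOn
    rintro _ ⟨x, hx, rfl⟩
    exact spectrum.algebraMap_mem ℂ hx
  rw [cfc_map_spectrum (fun x : ℝ ↦ max (x - t) 0) R] at h3
  refine Set.Finite.of_finite_image (h3.subset (Set.image_mono Set.inter_subset_left)) ?_
  rintro x ⟨_, hx⟩ y ⟨_, hy⟩ hxy
  rw [Set.mem_Ioi] at hx hy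
  simp only [max_eq_left (sub_nonneg.2 hx.le), max_eq_left (sub_nonneg.2 hy.le)] at hxy
  linarith

/-- The eigenspace of a bounded operator at a real point. -/
abbrev eigSpace (R : H →L[ℂ] H) (r : ℝ) : Submodule ℂ H :=
  Module.End.eigenspace (R : H →ₗ[ℂ] H) (r : ℂ)

omit [CompleteSpace H] in
theorem mem_eigSpace {r : ℝ} {x : H} : x ∈ eigSpace R r ↔ R x = (r : ℂ) • x :=
  Module.End.mem_eigenspace_iff

omit [CompleteSpace H] in
theorem neg_on_eigSpace {t r : ℝ} (h : t < r) {z : H} (hz : z ∈ eigSpace R r) (hz0 : z ≠ 0) :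
    t * ‖z‖ ^ 2 - (⟪z, R z⟫_ℂ).re < 0 := by
  rw [mem_eigSpace.1 hz, inner_smul_right, inner_self_eq_norm_sq_to_K, Complex.re_ofReal_mul]
  simp only [Complex.coe_algebraMap, ← Complex.ofReal_pow, Complex.ofReal_re]
  have : 0 < ‖z‖ ^ 2 := by positivity
  nlinarith

-- Makes the spectral projection at an isolated point accessible to the continuous functional
-- calculus.
open Classical in
theorem continuousOn_indicator_of_isolated {σ : Set ℝ} {r : ℝ} (h : ∀ᶠ x in 𝓝[≠] r, x ∉ σ) :
    ContinuousOn (fun x ↦ if x = r then (1 : ℝ) else 0) σ := by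
  intro x hx
  by_cases hxr : x = r
  · subst hxr
    have : ∀ᶠ y in 𝓝[σ] x, y = x := by
      rw [eventually_nhdsWithin_iff] at h ⊢
      filter_upwards [h] with y hy hyσ
      by_contra hne
      exact hy hne hyσ
    refine (continuousWithinAt_const (b := (1 : ℝ))).congr_of_eventuallyEq ?_ (by simp)
    filter_upwards [this] with y hy
    simp [hy]
  · refine (continuousWithinAt_const (b := (0 : ℝ))).congr_of_eventuallyEq ?_ (by simp [hxr])
    filter_upwards [nhdsWithin_le_nhds (isOpen_ne.mem_nhds hxr)] with y hy
    exact if_neg hy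

open Classical in
/-- The spectral projection of a self-adjoint operator at an isolated point of the spectrum. -/
noncomputable def pointProj (R : H →L[ℂ] H) (r : ℝ) : H →L[ℂ] H :=
  cfc (fun x : ℝ ↦ if x = r then (1 : ℝ) else 0) R

theorem pointProj_apply_mem (hR : IsSelfAdjoint R) {r : ℝ}
    (h : ∀ᶠ x in 𝓝[≠] r, x ∉ spectrum ℝ R) (y : H) : pointProj R r y ∈ eigSpace R r := by
  classical
  have hc := continuousOn_indicator_of_isolated h
  have h1 : cfc (fun x : ℝ ↦ x - r) R * pointProj R r = 0 := by
    rw [pointProj, ← cfc_mul _ _ R (by fun_prop) hc, ← cfc_zero ℝ R]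
    refine cfc_congr fun x _ ↦ ?_
    by_cases hx : x = r <;> simp [hx]
  have h2 := DFunLike.congr_fun h1 y
  rw [mul_apply_eq_comp, cfc_eq_sub_smul hR, zero_apply, sub_eq_zero] at h2
  rw [mem_eigSpace, h2]
  rfl

/-- By spectral mapping 1 lies in the spectrum of the point projection, so the projection is
nonzero, and its range consists of eigenvectors. -/
theorem eigSpace_ne_bot (hR : IsSelfAdjoint R) {r : ℝ} (hr : r ∈ spectrum ℝ R)
    (h : ∀ᶠ x in 𝓝[≠] r, x ∉ spectrum ℝ R) : eigSpace R r ≠ ⊥ := by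
  classical
  intro hbot
  have h1 : pointProj R r = 0 := by
    ext y
    have := pointProj_apply_mem hR h y
    rwa [hbot] at this
  have h2 : (1 : ℝ) ∈ spectrum ℝ (pointProj R r) := by
    rw [pointProj, cfc_map_spectrum _ R hR (continuousOn_indicator_of_isolated h)]
    exact ⟨r, hr, by simp⟩
  rw [h1, spectrum.mem_iff] at h2
  exact h2 (by simp)

theorem cfc_max_eq_sum {t : ℝ} (s : Finset ℝ)
    (hs : ∀ r, r ∈ s ↔ r ∈ spectrum ℝ R ∧ t < r)
    (hiso : ∀ r ∈ s, ∀ᶠ x in 𝓝[≠] r, x ∉ spectrum ℝ R) :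
    cfc (fun x : ℝ ↦ max (x - t) 0) R = ∑ r ∈ s, (r - t) • pointProj R r := by
  classical
  have h1 : ∀ r ∈ s, (r - t) • pointProj R r =
      cfc (fun x : ℝ ↦ (r - t) • (if x = r then (1 : ℝ) else 0)) R := fun r hr ↦
    (cfc_smul (r - t) _ R (continuousOn_indicator_of_isolated (hiso r hr))).symm
  rw [Finset.sum_congr rfl h1, ← cfc_sum
    (fun r x : ℝ ↦ (r - t) • (if x = r then (1 : ℝ) else 0)) R s fun r hr ↦
      (continuousOn_indicator_of_isolated (hiso r hr)).const_smul (r - t)]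
  refine cfc_congr fun x hx ↦ ?_
  simp only [Finset.sum_apply, smul_eq_mul, mul_ite, mul_one, mul_zero, Finset.sum_ite_eq, hs, hx,
    true_and]
  split_ifs with h
  · exact max_eq_left (sub_nonneg.2 h.le)
  · exact max_eq_right (by linarith)

/-- The pairs `(r, j)` of a point `r > t` and a number `j` below the multiplicity of `r`. -/
def eigPairs (R : H →L[ℂ] H) (t : ℝ) : Set (ℝ × ℕ) :=
  {p | t < p.1 ∧ (p.2 : ℕ∞) < Cardinal.toENat (Module.rank ℂ (eigSpace R p.1))}

/-- The index set is `eigPairs` itself, so that the dimension of the span is literally the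
eigenvalue count. -/
theorem exists_eigenbasis (hR : IsSelfAdjoint R) {t : ℝ}
    (hfin : ∀ r, t < r → FiniteDimensional ℂ (eigSpace R r)) :
    ∃ v : eigPairs R t → H, Orthonormal ℂ v ∧ (∀ p, v p ∈ eigSpace R p.1.1) ∧
      ∀ r, t < r → eigSpace R r ≤ Submodule.span ℂ (Set.range v) := by
  have hfin' : ∀ r : {r : ℝ // t < r}, FiniteDimensional ℂ (eigSpace R r) := fun r ↦ hfin r r.2
  let b : ∀ r : {r : ℝ // t < r}, OrthonormalBasis (Fin (Module.finrank ℂ (eigSpace R r))) ℂ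
    (eigSpace R r) := fun r ↦ stdOrthonormalBasis ℂ _
  have hlt : ∀ (r : {r : ℝ // t < r}) (j : ℕ),
      (j : ℕ∞) < Cardinal.toENat (Module.rank ℂ (eigSpace R r)) ↔
        j < Module.finrank ℂ (eigSpace R r) := fun r j ↦ by
    rw [toENat_rank_eq_finrank, Nat.cast_lt]
  have ho : OrthogonalFamily ℂ (fun r : {r : ℝ // t < r} ↦ eigSpace R r)
      fun r ↦ (eigSpace R r).subtypeₗᵢ :=
    hR.isSymmetric.orthogonalFamily_eigenspaces.comp (f := fun r : {r : ℝ // t < r} ↦ ((r : ℝ) : ℂ))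
      (Complex.ofReal_injective.comp Subtype.val_injective)
  have ho' := ho.orthonormal_sigma_orthonormal fun r ↦ (b r).orthonormal
  let e : eigPairs R t → Σ r : {r : ℝ // t < r}, Fin (Module.finrank ℂ (eigSpace R r)) :=
    fun p ↦ ⟨⟨p.1.1, p.2.1⟩, ⟨p.1.2, (hlt ⟨p.1.1, p.2.1⟩ _).1 p.2.2⟩⟩
  have he : Function.Injective e := by
    rintro ⟨⟨r, i⟩, hr, hi⟩ ⟨⟨r', i'⟩, hr', hi'⟩ h
    have h1 : r = r' := congrArg (fun x ↦ (x.1 : ℝ)) h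
    have h2 : i = i' := congrArg (fun x ↦ (x.2 : ℕ)) h
    subst h1 h2
    rfl
  refine ⟨_, ho'.comp e he, fun p ↦ (b ⟨p.1.1, p.2.1⟩ _).2, fun r hr x hx ↦ ?_⟩
  have h1 := congrArg (eigSpace R r).subtype ((b ⟨r, hr⟩).sum_repr ⟨x, hx⟩)
  rw [map_sum] at h1
  change _ = x at h1
  rw [← h1]
  refine Submodule.sum_mem _ fun j _ ↦ Submodule.smul_mem _ _ (Submodule.subset_span ?_)
  exact ⟨⟨(r, j), hr, (hlt ⟨r, hr⟩ j).2 j.2⟩, rfl⟩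

omit [CompleteSpace H] in
theorem neg_on_span {t : ℝ} {ι : Type*} {v : ι → H} {r : ι → ℝ}
    (hv : Orthonormal ℂ v) (hr : ∀ i, t < r i) (hvr : ∀ i, v i ∈ eigSpace R (r i)) {z : H}
    (hz : z ∈ Submodule.span ℂ (Set.range v)) (hz0 : z ≠ 0) :
    t * ‖z‖ ^ 2 - (⟪z, R z⟫_ℂ).re < 0 := by
  obtain ⟨c, rfl⟩ := Finsupp.mem_span_range_iff_exists_finsupp.1 hz
  rw [Finsupp.sum] at hz0 ⊢
  have h1 : R (∑ i ∈ c.support, c i • v i) = ∑ i ∈ c.support, (c i * r i) • v i := by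
    rw [map_sum]
    refine Finset.sum_congr rfl fun i _ ↦ ?_
    rw [map_smul, mem_eigSpace.1 (hvr i), smul_smul]
  rw [h1, hv.inner_sum, ← inner_self_eq_norm_sq (𝕜 := ℂ), hv.inner_sum]
  change t * (∑ i ∈ c.support, conj (c i) * c i).re -
    (∑ i ∈ c.support, conj (c i) * (c i * r i)).re < 0
  rw [Complex.re_sum, Complex.re_sum, Finset.mul_sum, ← Finset.sum_sub_distrib]
  refine Finset.sum_neg (fun i hi ↦ ?_) ?_
  · rw [← mul_assoc, ← Complex.normSq_eq_conj_mul_self, Complex.re_mul_ofReal, Complex.ofReal_re]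
    have := Complex.normSq_pos.2 (Finsupp.mem_support_iff.1 hi)
    nlinarith [hr i]
  · by_contra h
    rw [Finset.not_nonempty_iff_eq_empty] at h
    simp [h] at hz0

/-- The form is negative on the span of the eigenvectors above `t`, which gives one bound and
settles the case of infinitely many pairs. For finitely many, (R − t)₊ is a finite combination of
point projections and maps into this span, while the form is nonnegative on its kernel. -/
theorem formIndex_eq_encard (hR : IsSelfAdjoint R) {t : ℝ}
    (hfin : ∀ r, t < r → FiniteDimensional ℂ (eigSpace R r))
    (hiso : ∀ r ∈ spectrum ℝ R, t < r → ∀ᶠ x in 𝓝[≠] r, x ∉ spectrum ℝ R) :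
    formIndex (fun y ↦ t * ‖y‖ ^ 2 - (⟪y, R y⟫_ℂ).re) = (eigPairs R t).encard := by
  obtain ⟨v, hv, hvr, hspan⟩ := exists_eigenbasis hR hfin
  have hrank : Cardinal.toENat (Module.rank ℂ (Submodule.span ℂ (Set.range v))) =
      (eigPairs R t).encard := by
    rw [rank_span hv.linearIndependent, ← Cardinal.toENat_lift,
      Cardinal.mk_range_eq_of_injective hv.linearIndependent.injective, Cardinal.toENat_lift]
    rfl
  refine le_antisymm ?_ ?_
  · by_cases htop : (eigPairs R t).encard = ⊤
    · rw [htop]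
      exact le_top
    have hP : (eigPairs R t).Finite := Set.encard_ne_top_iff.1 htop
    have hs : (spectrum ℝ R ∩ Set.Ioi t).Finite := by
      -- Each spectral point above `t` is isolated, hence an eigenvalue, so it is seen by the pair
      -- with second entry 0.
      refine (hP.image Prod.fst).subset fun r hr ↦ ⟨(r, 0), ⟨hr.2, ?_⟩, rfl⟩
      have := hfin r hr.2
      have h2 := eigSpace_ne_bot hR hr.1 (hiso r hr.1 hr.2)
      rw [toENat_rank_eq_finrank, Nat.cast_lt, Nat.pos_iff_ne_zero]
      exact fun h ↦ h2 (Submodule.finrank_eq_zero.1 h)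
    have hmem : ∀ y, cfc (fun x : ℝ ↦ max (x - t) 0) R y ∈ Submodule.span ℂ (Set.range v) := by
      intro y
      have hs' : ∀ r, r ∈ hs.toFinset ↔ r ∈ spectrum ℝ R ∧ t < r := by simp
      rw [cfc_max_eq_sum hs.toFinset hs'
        fun r hr ↦ hiso r ((hs' r).1 hr).1 ((hs' r).1 hr).2, sum_apply]
      refine Submodule.sum_mem _ fun r hr ↦ ?_
      have hr' := (hs' r).1 hr
      rw [smul_apply]
      exact Submodule.smul_of_tower_mem _ _
        (hspan r hr'.2 (pointProj_apply_mem hR (hiso r hr'.1 hr'.2) y))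
    rw [← hrank]
    refine formIndex_le_of_ker (LinearMap.codRestrict _
      (cfc (fun x : ℝ ↦ max (x - t) 0) R).toLinearMap hmem) fun y hy ↦ ?_
    exact nonneg_of_cfc_max_apply_eq_zero hR (congrArg Subtype.val hy)
  · rw [← hrank]
    exact toENat_rank_le_formIndex fun z ↦
      neg_on_span (r := fun p : eigPairs R t ↦ p.1.1) hv (fun p ↦ p.2.1) hvr

end SelfAdjoint

/-! ### Spectral mapping between an unbounded operator and its resolvent. -/

section Resolvent

open Filter Topology

variable {H : Type*} [NormedAddCommGroup H] [InnerProductSpace ℂ H]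
  {A : H →ₗ.[ℂ] H} {R : H →L[ℂ] H}

theorem IsResolventAt.apply_eq_iff {z : ℂ} (h : IsResolventAt A z R) {x y : H} :
    R y = x ↔ ∃ hx : x ∈ A.domain, A ⟨x, hx⟩ = z • x + y := by
  constructor
  · rintro rfl
    obtain ⟨hx, e⟩ := h.2 y
    exact ⟨hx, by rw [add_comm]; exact sub_eq_iff_eq_add.1 e⟩
  · rintro ⟨hx, e⟩
    have := h.1 ⟨x, hx⟩
    rw [e] at this
    simpa using this

theorem IsResolventAt.mem_opEigenspace_iff {z w : ℂ} (h : IsResolventAt A z R) (hw : w ≠ z)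
    {x : H} :
    x ∈ opEigenspace A w ↔ R x = (w - z)⁻¹ • x := by
  have hne : w - z ≠ 0 := sub_ne_zero.2 hw
  have h1 : R x = (w - z)⁻¹ • x ↔ R ((w - z) • x) = x := by
    rw [map_smul]
    constructor
    · intro e
      rw [e, smul_inv_smul₀ hne]
    · intro e
      rw [← e, inv_smul_smul₀ hne, e]
  rw [h1, h.apply_eq_iff]
  change (∃ hx : x ∈ A.domain, A ⟨x, hx⟩ = w • x) ↔ _
  simp only [← add_smul, add_sub_cancel]

/-- The factorization A − w = (1 − (w − z) R)(A − z) reduces invertibility of A − w to that of 1 −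
(w − z) R. In one direction the resolvent identities show that 1 + (w − z) Rw is the inverse of that
factor; in the other, u = (w − z)⁻¹ − R yields the resolvent (w − z)⁻¹ R u⁻¹. -/
theorem IsResolventAt.mem_opResolventSet_iff {z w : ℂ} (h : IsResolventAt A z R) (hw : w ≠ z) :
    w ∈ opResolventSet A ↔ (w - z)⁻¹ ∉ spectrum ℂ R := by
  have hne : w - z ≠ 0 := sub_ne_zero.2 hw
  rw [spectrum.notMem_iff]
  constructor
  · rintro ⟨Rw, hRw⟩
    have h1 : Rw = R + (w - z) • (R * Rw) := by
      ext y
      obtain ⟨hx, e⟩ := hRw.2 y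
      symm
      have : R (y + (w - z) • Rw y) = Rw y := by
        rw [h.apply_eq_iff]
        refine ⟨hx, ?_⟩
        rw [sub_eq_iff_eq_add.1 e, sub_smul]
        abel
      simpa using this
    have h2 : R = Rw - (w - z) • (Rw * R) := by
      ext y
      obtain ⟨hx, e⟩ := h.2 y
      symm
      have : Rw (y - (w - z) • R y) = R y := by
        rw [hRw.apply_eq_iff]
        refine ⟨hx, ?_⟩
        rw [sub_eq_iff_eq_add.1 e, sub_smul]
        abel
      simpa using this
    have h3 : (1 - (w - z) • R) * (1 + (w - z) • Rw) = 1 := by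
      have : (w - z) • Rw = (w - z) • R + (w - z) • ((w - z) • (R * Rw)) := by
        rw [← smul_add, ← h1]
      calc (1 - (w - z) • R) * (1 + (w - z) • Rw)
          = 1 + (w - z) • Rw - (w - z) • R - (w - z) • ((w - z) • (R * Rw)) := by
            simp only [sub_mul, mul_add, one_mul, mul_one, smul_mul_assoc,
              mul_smul_comm, smul_sub]; abel
        _ = 1 := by nth_rewrite 1 [this]; abel
    have h4 : (1 + (w - z) • Rw) * (1 - (w - z) • R) = 1 := by
      have : (w - z) • R = (w - z) • Rw - (w - z) • ((w - z) • (Rw * R)) := by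
        rw [← smul_sub, ← h2]
      calc (1 + (w - z) • Rw) * (1 - (w - z) • R)
          = 1 - (w - z) • R + (w - z) • Rw - (w - z) • ((w - z) • (Rw * R)) := by
            simp only [mul_sub, add_mul, one_mul, mul_one, smul_mul_assoc,
              mul_smul_comm, smul_add]; abel
        _ = 1 := by nth_rewrite 1 [this]; abel
    have h5 : IsUnit (1 - (w - z) • R) := ⟨⟨_, _, h3, h4⟩, rfl⟩
    have h6 : algebraMap ℂ (H →L[ℂ] H) (w - z)⁻¹ - R =
        algebraMap ℂ (H →L[ℂ] H) (w - z)⁻¹ * (1 - (w - z) • R) := by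
      rw [mul_sub, mul_one, Algebra.algebraMap_eq_smul_one, smul_one_mul, inv_smul_smul₀ hne]
    rw [h6]
    exact ((IsUnit.mk0 _ (inv_ne_zero hne)).map _).mul h5
  · rintro ⟨u, hu⟩
    have hu' : ∀ y, (u : H →L[ℂ] H) y = (w - z)⁻¹ • y - R y := by
      intro y
      rw [hu]
      simp [Algebra.algebraMap_eq_smul_one]
    have hui : ∀ y, (u : H →L[ℂ] H) ((↑u⁻¹ : H →L[ℂ] H) y) = y := fun y ↦
      DFunLike.congr_fun u.mul_inv y
    have hiu : ∀ y, (↑u⁻¹ : H →L[ℂ] H) ((u : H →L[ℂ] H) y) = y := fun y ↦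
      DFunLike.congr_fun u.inv_mul y
    have hcomm : ∀ y, R ((↑u⁻¹ : H →L[ℂ] H) y) = (↑u⁻¹ : H →L[ℂ] H) (R y) := by
      intro y
      have e1 : R y = (u : H →L[ℂ] H) (R ((↑u⁻¹ : H →L[ℂ] H) y)) := by
        rw [hu', ← map_smul, ← map_sub, ← hu', hui]
      rw [e1, hiu]
    refine ⟨(w - z)⁻¹ • (R * ↑u⁻¹), ?_, ?_⟩
    · intro x
      have e : R (A x - z • (x : H)) = x := h.1 x
      have e2 : R (A x - w • (x : H)) = (w - z) • (u : H →L[ℂ] H) x := by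
        have : A x - w • (x : H) = (A x - z • (x : H)) - (w - z) • (x : H) := by
          rw [sub_smul]; abel
        rw [this, map_sub, e, hu', smul_sub, smul_inv_smul₀ hne, map_smul]
      rw [smul_apply, mul_apply_eq_comp, hcomm, e2, map_smul, hiu, inv_smul_smul₀ hne]
    · intro y
      have e : R ((w - z)⁻¹ • (↑u⁻¹ : H →L[ℂ] H) y) = ((w - z)⁻¹ • (R * ↑u⁻¹) : H →L[ℂ] H) y := by
        simp
      obtain ⟨hx, hA⟩ := h.apply_eq_iff.1 e
      refine ⟨hx, ?_⟩
      rw [hA]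
      have e3 := hu' ((↑u⁻¹ : H →L[ℂ] H) y)
      rw [hui] at e3
      nth_rewrite 4 [e3]
      rw [smul_apply, mul_apply_eq_comp, smul_smul, smul_smul]
      have : w * (w - z)⁻¹ = 1 + z * (w - z)⁻¹ := by field_simp; ring
      rw [this, add_smul, one_smul]
      abel

theorem opEigenspace_eq_bot_of_mem_opResolventSet {z : ℂ} (hz : z ∈ opResolventSet A) :
    opEigenspace A z = ⊥ := by
  obtain ⟨R, hR⟩ := hz
  rw [eq_bot_iff]
  rintro x ⟨hx, e⟩
  have := hR.1 ⟨x, hx⟩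
  rw [e] at this
  simpa using this.symm

theorem mem_opSpectrum_of_eigMult_pos {z : ℂ} (h : 0 < eigMult A z) : z ∈ opSpectrum A := by
  intro hz
  rw [eigMult, opEigenspace_eq_bot_of_mem_opResolventSet hz] at h
  simp at h

theorem isolated_iff {σ : Set ℂ} {z : ℂ} :
    (∃ ε > 0, ∀ w ∈ σ, w ≠ z → ε ≤ dist w z) ↔ ∀ᶠ w in 𝓝[≠] z, w ∉ σ := by
  rw [Metric.nhdsWithin_basis_ball.eventually_iff]
  refine exists_congr fun ε ↦ and_congr_right fun _ ↦ ?_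
  constructor
  · rintro h w ⟨hw, hne⟩ hσ
    exact absurd hw (not_lt.2 (h w hσ hne))
  · intro h w hσ hne
    by_contra hlt
    exact h ⟨not_le.1 hlt, hne⟩ hσ

end Resolvent

/-! ### Eigenvalues above ζ through the index of (x − ζ)⁻¹ − R. -/

section Levels

open Filter Topology

variable {H : Type*} [NormedAddCommGroup H] [InnerProductSpace ℂ H] [CompleteSpace H]
  {A : H →ₗ.[ℂ] H} {R : H →L[ℂ] H} {ζ : ℝ}

omit [CompleteSpace H] in
theorem IsResolventAt.ofReal_mem_opSpectrum_iff (h : IsResolventAt A ζ R) {x : ℝ} (hx : x ≠ ζ) :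
    (x : ℂ) ∈ opSpectrum A ↔ (x - ζ)⁻¹ ∈ spectrum ℝ R := by
  have h1 : (x : ℂ) ≠ ζ := by exact_mod_cast hx
  rw [opSpectrum, Set.mem_compl_iff, h.mem_opResolventSet_iff h1, not_not,
    ← spectrum.algebraMap_mem_iff ℂ (r := (x - ζ)⁻¹), Complex.coe_algebraMap, Complex.ofReal_inv,
    Complex.ofReal_sub]

omit [CompleteSpace H] in
theorem IsResolventAt.opEigenspace_ofReal (h : IsResolventAt A ζ R) {x : ℝ} (hx : x ≠ ζ) :
    opEigenspace A x = eigSpace R (x - ζ)⁻¹ := by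
  have h1 : (x : ℂ) ≠ ζ := by exact_mod_cast hx
  ext y
  rw [h.mem_opEigenspace_iff h1, mem_eigSpace]
  simp

theorem IsResolventAt.eq_ofReal_of_mem_opSpectrum (h : IsResolventAt A ζ R) (hR : IsSelfAdjoint R)
    {w : ℂ} (hw : w ∈ opSpectrum A) : w = w.re := by
  by_cases hne : w = ζ
  · simp [hne]
  have h1 : (w - ζ)⁻¹ ∈ spectrum ℂ R := by
    by_contra hn
    exact hw ((h.mem_opResolventSet_iff hne).2 hn)
  have h2 := congrArg (fun z ↦ (z⁻¹).im) (hR.mem_spectrum_eq_re h1)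
  simp only [inv_inv, ← Complex.ofReal_inv, Complex.ofReal_im] at h2
  refine Complex.ext rfl ?_
  simpa using h2

omit [CompleteSpace H] in
theorem IsResolventAt.eventually_notMem_spectrum (h : IsResolventAt A ζ R) {x : ℝ} (hx : x ≠ ζ)
    (hiso : ∀ᶠ w in 𝓝[≠] (x : ℂ), w ∉ opSpectrum A) :
    ∀ᶠ r in 𝓝[≠] (x - ζ)⁻¹, r ∉ spectrum ℝ R := by
  have hne : (x - ζ)⁻¹ ≠ 0 := inv_ne_zero (sub_ne_zero.2 hx)
  have h1 : Tendsto (fun r : ℝ ↦ ((ζ + r⁻¹ : ℝ) : ℂ)) (𝓝[≠] (x - ζ)⁻¹) (𝓝[≠] (x : ℂ)) := by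
    refine tendsto_nhdsWithin_of_tendsto_nhds_of_eventually_within _ ?_ ?_
    · have : ContinuousAt (fun r : ℝ ↦ ((ζ + r⁻¹ : ℝ) : ℂ)) (x - ζ)⁻¹ :=
        Complex.continuous_ofReal.continuousAt.comp (continuousAt_const.add (continuousAt_inv₀ hne))
      have h2 := this.tendsto
      simp only [inv_inv, add_sub_cancel] at h2
      exact h2.mono_left nhdsWithin_le_nhds
    · filter_upwards [self_mem_nhdsWithin] with r hr hcon
      refine hr ?_
      have : ζ + r⁻¹ = x := Complex.ofReal_injective hcon
      rw [← this]
      simp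
  have h0 : ∀ᶠ r in 𝓝[≠] (x - ζ)⁻¹, r ≠ 0 := nhdsWithin_le_nhds (isOpen_ne.mem_nhds hne)
  filter_upwards [h1.eventually hiso, h0] with r hr hr0 hcon
  refine hr ((h.ofReal_mem_opSpectrum_iff ?_).2 ?_)
  · simpa using hr0
  · simpa using hcon

theorem IsResolventAt.eventually_notMem_of_notMem_essentialSpectrum (h : IsResolventAt A ζ R)
    {x : ℝ} (hx : x ≠ ζ) (hess : (x : ℂ) ∉ essentialSpectrum A) :
    ∀ᶠ w in 𝓝[≠] (x : ℂ), w ∉ opSpectrum A := by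
  have hx' : (x : ℂ) ≠ ζ := by exact_mod_cast hx
  by_cases hσ : (x : ℂ) ∈ opSpectrum A
  · by_contra hcon
    exact hess ⟨hσ, fun hd ↦ hcon (isolated_iff.1 hd.2.1)⟩
  · have h1 : ((x : ℂ) - ζ)⁻¹ ∉ spectrum ℂ R :=
      (h.mem_opResolventSet_iff hx').1 (not_not.1 hσ)
    have h2 : ContinuousAt (fun w : ℂ ↦ (w - ζ)⁻¹) x :=
      ContinuousAt.inv₀ (by fun_prop) (sub_ne_zero.2 hx')
    have h3 := h2.eventually_mem ((spectrum.isClosed (𝕜 := ℂ) R).isOpen_compl.mem_nhds h1)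
    refine nhdsWithin_le_nhds ?_
    filter_upwards [h3, isOpen_ne.mem_nhds hx'] with w hw hne
    exact not_not.2 ((h.mem_opResolventSet_iff hne).2 hw)

/-- The negative index of `(x - ζ)⁻¹ - R`. -/
noncomputable def resolventIndex (R : H →L[ℂ] H) (ζ x : ℝ) : ℕ∞ :=
  formIndex fun y ↦ (x - ζ)⁻¹ * ‖y‖ ^ 2 - (⟪y, R y⟫_ℂ).re

omit [CompleteSpace H] in
theorem resolventIndex_mono {x y : ℝ} (hx : ζ < x) (hxy : x ≤ y) :
    resolventIndex R ζ x ≤ resolventIndex R ζ y := by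
  refine formIndex_le_of_map LinearMap.id (fun z hz ↦ lt_of_le_of_lt ?_ hz) (by simp)
  have h1 : (y - ζ)⁻¹ ≤ (x - ζ)⁻¹ := inv_anti₀ (sub_pos.2 hx) (by linarith)
  have := mul_le_mul_of_nonneg_right h1 (sq_nonneg ‖z‖)
  simpa using this

omit [CompleteSpace H] in
-- Here (x − ζ)⁻¹ ≥ ‖R‖, so the form is nonnegative. This keeps the infimum in
-- `exists_isNthEigenvalue` strictly above `ζ`.
theorem resolventIndex_eq_zero {x : ℝ} (hx : ζ < x) (h : (x - ζ) * ‖R‖ ≤ 1) :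
    resolventIndex R ζ x = 0 := by
  refine le_antisymm ((formIndex_le_of_ker (0 : H →ₗ[ℂ] (Fin 0 → ℂ)) fun y _ ↦ ?_).trans ?_)
    zero_le
  · have h1 : (⟪y, R y⟫_ℂ).re ≤ ‖R‖ * ‖y‖ ^ 2 := by
      calc (⟪y, R y⟫_ℂ).re ≤ ‖⟪y, R y⟫_ℂ‖ := Complex.re_le_norm _
        _ ≤ ‖y‖ * ‖R y‖ := norm_inner_le_norm _ _
        _ ≤ ‖y‖ * (‖R‖ * ‖y‖) := by gcongr; exact R.le_opNorm y
        _ = _ := by ring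
    have h2 : ‖R‖ ≤ (x - ζ)⁻¹ := by
      rw [← one_div, le_div_iff₀ (sub_pos.2 hx)]
      linarith
    have := mul_le_mul_of_nonneg_right h2 (sq_nonneg ‖y‖)
    linarith
  · simp

/-- The map y ↦ (y − ζ)⁻¹ is a decreasing bijection of (ζ, x) onto ((x − ζ)⁻¹, ∞) that preserves
eigenspaces. -/
theorem IsResolventAt.resolventIndex_eq_eigCount (h : IsResolventAt A ζ R) (hR : IsSelfAdjoint R)
    {x : ℝ} (hx : ζ < x) (hess : ∀ y, ζ < y → y < x → (y : ℂ) ∉ essentialSpectrum A) :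
    resolventIndex R ζ x = eigCount A (Set.Ioo ζ x) := by
  have hx0 : 0 < (x - ζ)⁻¹ := inv_pos.2 (sub_pos.2 hx)
  have hr : ∀ r, (x - ζ)⁻¹ < r → ∃ y, ζ < y ∧ y < x ∧ (y - ζ)⁻¹ = r := by
    intro r hr
    refine ⟨ζ + r⁻¹, ?_, ?_, by simp⟩
    · have : 0 < r⁻¹ := inv_pos.2 (hx0.trans hr)
      linarith
    · have := inv_strictAnti₀ hx0 hr
      rw [inv_inv] at this
      linarith
  rw [resolventIndex, formIndex_eq_encard hR]
  · refine Set.encard_congr ⟨fun p ↦ ⟨(ζ + p.1.1⁻¹, p.1.2), ?_⟩,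
      fun p ↦ ⟨((p.1.1 - ζ)⁻¹, p.1.2), ?_⟩, fun p ↦ ?_, fun p ↦ ?_⟩
    · obtain ⟨⟨r, j⟩, h1, h2⟩ := p
      obtain ⟨y, hy, hy', rfl⟩ := hr r h1
      have : ζ + ((y - ζ)⁻¹)⁻¹ = y := by simp
      simp only [this]
      refine ⟨⟨hy, hy'⟩, ?_⟩
      change (j : ℕ∞) < Cardinal.toENat (Module.rank ℂ (opEigenspace A y))
      rw [h.opEigenspace_ofReal hy.ne']
      exact h2
    · obtain ⟨⟨y, j⟩, ⟨hy, hy'⟩, h2⟩ := p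
      change (j : ℕ∞) < Cardinal.toENat (Module.rank ℂ (opEigenspace A y)) at h2
      rw [h.opEigenspace_ofReal (ne_of_gt hy)] at h2
      refine ⟨inv_strictAnti₀ (sub_pos.2 hy) ?_, h2⟩
      exact sub_lt_sub_right hy' ζ
    · simp
    · simp
  · intro r hlt
    obtain ⟨y, hy, hy', rfl⟩ := hr r hlt
    rw [← h.opEigenspace_ofReal hy.ne']
    by_cases hσ : (y : ℂ) ∈ opSpectrum A
    · by_cases hd : (y : ℂ) ∈ discreteSpectrum A
      · exact finiteDimensional_of_toENat_rank_lt_top hd.2.2.2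
      · exact absurd ⟨hσ, hd⟩ (hess y hy hy')
    · rw [opEigenspace_eq_bot_of_mem_opResolventSet (not_not.1 hσ)]
      infer_instance
  · intro r hσ hlt
    obtain ⟨y, hy, hy', rfl⟩ := hr r hlt
    exact h.eventually_notMem_spectrum hy.ne'
      (h.eventually_notMem_of_notMem_essentialSpectrum hy.ne' (hess y hy hy'))

/-- Finite index leaves finitely many points of the spectrum of `R` above (x − ζ)⁻¹, so the spectrum
of `A` near `y` is finite and `y` is isolated in it. Its eigenspace is a negative subspace, hence
finite-dimensional. -/
theorem IsResolventAt.notMem_essentialSpectrum (h : IsResolventAt A ζ R) (hR : IsSelfAdjoint R)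
    {x y : ℝ} (hy : ζ < y) (hyx : y < x) (hx : resolventIndex R ζ x < ⊤) :
    (y : ℂ) ∉ essentialSpectrum A := by
  rintro ⟨hσ, hd⟩
  have hfin := finite_spectrum_of_formIndex_lt_top hR hx
  have hlt : (x - ζ)⁻¹ < (y - ζ)⁻¹ := inv_strictAnti₀ (sub_pos.2 hy) (by linarith)
  have hiso : ∀ᶠ w in 𝓝[≠] (y : ℂ), w ∉ opSpectrum A := by
    have hF := (hfin.image fun r ↦ ((ζ + r⁻¹ : ℝ) : ℂ)).subset
      (Set.sdiff_subset (t := {(y : ℂ)}))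
    have h1 := hF.isClosed.isOpen_compl.mem_nhds (x := (y : ℂ)) (by simp)
    have h2 : ∀ᶠ w in 𝓝 (y : ℂ), w.re ∈ Set.Ioo ζ x :=
      Complex.continuous_re.continuousAt.eventually_mem (Ioo_mem_nhds hy hyx)
    filter_upwards [nhdsWithin_le_nhds h1, nhdsWithin_le_nhds h2, self_mem_nhdsWithin]
      with w hw hre hne hwσ
    have hw' := h.eq_ofReal_of_mem_opSpectrum hR hwσ
    refine hw ⟨⟨(w.re - ζ)⁻¹, ⟨?_, ?_⟩, ?_⟩, hne⟩
    · rw [hw'] at hwσ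
      exact (h.ofReal_mem_opSpectrum_iff hre.1.ne').1 hwσ
    · exact inv_strictAnti₀ (sub_pos.2 hre.1) (by linarith [hre.2])
    · simpa using hw'.symm
  refine hd ⟨hσ, isolated_iff.2 hiso, ?_, ?_⟩
  · have h1 := eigSpace_ne_bot hR ((h.ofReal_mem_opSpectrum_iff hy.ne').1 hσ)
      (h.eventually_notMem_spectrum hy.ne' hiso)
    rw [eigMult, h.opEigenspace_ofReal hy.ne', pos_iff_ne_zero]
    intro h0
    have := finiteDimensional_of_toENat_rank_lt_top (h0.trans_lt ENat.top_pos)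
    rw [toENat_rank_eq_finrank, Nat.cast_eq_zero] at h0
    exact h1 (Submodule.finrank_eq_zero.1 h0)
  · rw [eigMult, h.opEigenspace_ofReal hy.ne']
    exact (toENat_rank_le_formIndex fun z ↦ neg_on_eigSpace hlt).trans_lt hx

omit [CompleteSpace H] in
theorem le_essBottom_iff {x : ℝ} : (x : EReal) ≤ essBottom A ζ ↔
    ∀ y, ζ < y → y < x → (y : ℂ) ∉ essentialSpectrum A := by
  rw [essBottom, le_sInf_iff, Set.forall_mem_image]
  simp only [Set.mem_ofPred_eq, EReal.coe_le_coe_iff]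
  exact ⟨fun h y hy hyx hess ↦ absurd (h ⟨hy, hess⟩) (not_le.2 hyx),
    fun h y hy ↦ not_lt.1 fun hyx ↦ h y hy.1 hyx hy.2⟩

omit [CompleteSpace H] in
theorem le_essBottom : (ζ : EReal) ≤ essBottom A ζ :=
  le_essBottom_iff.2 fun _ hy hy' ↦ absurd hy hy'.not_gt

omit [CompleteSpace H] in
theorem eigCount_mono {J K : Set ℝ} (h : ∀ x ∈ J, 0 < eigMult A x → x ∈ K) :
    eigCount A J ≤ eigCount A K :=
  Set.encard_le_encard fun _ hp ↦ ⟨h _ hp.1 (pos_of_gt hp.2), hp.2⟩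

omit [CompleteSpace H] in
/-- If the eigenvalues below `μ` are more than `n`, so are those below some smaller number. -/
theorem exists_lt_eigCount_Ioo {μ : ℝ} {n : ℕ} (h : n < eigCount A (Set.Ioo ζ μ)) :
    ∃ x, ζ < x ∧ x < μ ∧ n < eigCount A (Set.Ioo ζ x) := by
  -- Only `n + 1` pairs are kept: being finitely many, they have a largest eigenvalue, and `x` fits
  -- between it and `μ`.
  obtain ⟨s, hs, hcard⟩ := Set.exists_subset_encard_eq (Order.add_one_le_of_lt h)
  have hsfin : s.Finite := Set.finite_of_encard_eq_coe (k := n + 1) (by simpa using hcard)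
  have hne : s.Nonempty := by
    rw [← Set.encard_pos, hcard]
    exact pos_of_gt (ENat.lt_add_one_iff (ENat.natCast_ne_top n) |>.2 le_rfl)
  obtain ⟨p, hp, hmax⟩ := Set.exists_max_image s Prod.fst hsfin hne
  obtain ⟨x, hpx, hxμ⟩ := exists_between (hs hp).1.2
  refine ⟨x, (hs hp).1.1.trans hpx, hxμ, ?_⟩
  refine lt_of_lt_of_le (ENat.lt_add_one_iff (ENat.natCast_ne_top n) |>.2 le_rfl)
    (hcard.symm.le.trans (Set.encard_le_encard fun q hq ↦ ⟨⟨(hs hq).1.1, ?_⟩, (hs hq).2⟩))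
  exact (hmax q hq).trans_lt hpx

theorem sInf_coe_image_Ioi (μ : ℝ) : sInf ((fun x : ℝ ↦ (x : EReal)) '' Set.Ioi μ) = μ := by
  refine le_antisymm (le_of_forall_gt fun b hb ↦ ?_) (le_sInf ?_)
  · obtain ⟨x, hx, hxb⟩ := EReal.lt_iff_exists_real_btwn.1 hb
    exact (sInf_le (Set.mem_image_of_mem _ (EReal.coe_lt_coe_iff.1 hx))).trans_lt hxb
  · rintro _ ⟨x, hx, rfl⟩
    exact EReal.coe_le_coe_iff.2 (le_of_lt hx)

/-- The eigenvalue is the infimum `μ` of the points where the index exceeds `n`. The count over (ζ,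
y) is left continuous in y, so at most `n` eigenvalues lie below `μ`. Since `μ` is not in the
essential spectrum, there is no spectrum just above it, so the excess occurs at `μ` itself. -/
theorem IsResolventAt.exists_isNthEigenvalue (h : IsResolventAt A ζ R) (hR : IsSelfAdjoint R)
    {n : ℕ} {x : ℝ} (hx : ζ < x) (hn : n < resolventIndex R ζ x)
    (hxe : (x : EReal) < essBottom A ζ) :
    ∃ μ, IsNthEigenvalue A (gapAbove A ζ) n μ := by
  have hcount : ∀ y : ℝ, ζ < y → (y : EReal) ≤ essBottom A ζ →
      resolventIndex R ζ y = eigCount A (Set.Ioo ζ y) := fun y hy hye ↦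
    h.resolventIndex_eq_eigCount hR hy (le_essBottom_iff.1 hye)
  set X : Set ℝ := {y | ζ < y ∧ n < resolventIndex R ζ y} with hX
  have hbdd : BddBelow X := ⟨ζ, fun y hy ↦ hy.1.le⟩
  have hXne : X.Nonempty := ⟨x, hx, hn⟩
  set μ := sInf X with hμ
  have hμx : μ ≤ x := csInf_le hbdd ⟨hx, hn⟩
  have hμe : (μ : EReal) < essBottom A ζ := (EReal.coe_le_coe_iff.2 hμx).trans_lt hxe
  have hζμ : ζ < μ := by
    -- The index vanishes within this distance of `ζ`; adding 1 covers `R = 0`.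
    have hpos : 0 < (‖R‖ + 1)⁻¹ := by positivity
    refine lt_of_lt_of_le (b := ζ + (‖R‖ + 1)⁻¹) (by linarith) (le_csInf hXne fun y hy ↦ ?_)
    by_contra hlt
    refine absurd hy.2 ?_
    rw [resolventIndex_eq_zero hy.1]
    · simp
    · calc (y - ζ) * ‖R‖ ≤ (‖R‖ + 1)⁻¹ * (‖R‖ + 1) := by
            gcongr
            · linarith
            · linarith
        _ = 1 := inv_mul_cancel₀ (by positivity)
  have hIoo : gapAbove A ζ ∩ Set.Iio μ = Set.Ioo ζ μ := by
    ext y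
    constructor
    · rintro ⟨⟨h1, -⟩, h2⟩
      exact ⟨h1, h2⟩
    · rintro ⟨h1, h2⟩
      exact ⟨⟨h1, (EReal.coe_lt_coe_iff.2 h2).trans hμe⟩, h2⟩
  have hle : eigCount A (gapAbove A ζ ∩ Set.Iio μ) ≤ n := by
    rw [hIoo]
    by_contra hcon
    obtain ⟨y, hy, hyμ, hny⟩ := exists_lt_eigCount_Ioo (not_le.1 hcon)
    rw [← hcount y hy ((EReal.coe_lt_coe_iff.2 hyμ).trans hμe).le] at hny
    exact absurd (csInf_le hbdd ⟨hy, hny⟩) (not_le.2 hyμ)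
  have hlt : (n : ℕ∞) < eigCount A (gapAbove A ζ ∩ Set.Iic μ) := by
    have hess : (μ : ℂ) ∉ essentialSpectrum A := by
      obtain ⟨y, hμy, hye⟩ := EReal.lt_iff_exists_real_btwn.1 hμe
      exact le_essBottom_iff.1 hye.le μ hζμ (EReal.coe_lt_coe_iff.1 hμy)
    have h1 := isolated_iff.2 (h.eventually_notMem_of_notMem_essentialSpectrum hζμ.ne' hess)
    obtain ⟨ε, hε, hiso⟩ := h1
    -- Between `μ` and this minimum there is neither essential spectrum nor any other point of the
    -- spectrum.
    have h2 : (μ : EReal) < min (essBottom A ζ) ((μ + ε : ℝ) : EReal) :=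
      lt_min hμe (EReal.coe_lt_coe_iff.2 (by linarith))
    obtain ⟨y, hμy, hye⟩ := EReal.lt_iff_exists_real_btwn.1 h2
    rw [lt_min_iff, EReal.coe_lt_coe_iff] at hye
    rw [EReal.coe_lt_coe_iff] at hμy
    obtain ⟨z, hz, hzy⟩ := (csInf_lt_iff hbdd hXne).1 hμy
    have h3 : (n : ℕ∞) < eigCount A (Set.Ioo ζ y) := by
      rw [← hcount y (hζμ.trans hμy) hye.1.le]
      exact hz.2.trans_le (resolventIndex_mono hz.1 hzy.le)
    refine h3.trans_le (eigCount_mono fun w hw hw0 ↦ ?_)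
    refine ⟨⟨hw.1, (EReal.coe_lt_coe_iff.2 hw.2).trans hye.1⟩, ?_⟩
    by_contra hμw
    rw [Set.mem_Iic, not_le] at hμw
    have h4 := hiso w (mem_opSpectrum_of_eigMult_pos hw0) (by exact_mod_cast hμw.ne')
    rw [Complex.dist_of_im_eq (by simp), Complex.ofReal_re, Complex.ofReal_re, Real.dist_eq,
      abs_of_pos (sub_pos.2 hμw)] at h4
    linarith [hw.2, hye.2]
  refine ⟨μ, ⟨hζμ, hμe⟩, ?_, hle, hlt⟩
  by_contra h0
  have h1 : eigCount A (gapAbove A ζ ∩ Set.Iic μ) ≤ eigCount A (gapAbove A ζ ∩ Set.Iio μ) := by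
    refine eigCount_mono fun w hw hw0 ↦ 
      ⟨hw.1, Set.mem_Iio.2 (lt_of_le_of_ne (Set.mem_Iic.1 hw.2) fun hwμ ↦ h0 ?_)⟩
    rwa [hwμ] at hw0
  exact absurd hlt (not_lt.2 (h1.trans hle))

/-- If the eigenvalue `μ` exists, the set on the right is exactly (μ, ∞). Otherwise the index is at
most `n` below the essential bottom and infinite above it; its value at the bottom does not affect
the infimum. -/
theorem IsResolventAt.nthLevel_eq_sInf (h : IsResolventAt A ζ R) (hR : IsSelfAdjoint R) (n : ℕ) :
    nthLevel A ζ n = sInf ((fun x : ℝ ↦ (x : EReal)) ''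
      {x : ℝ | ζ < x ∧ n < resolventIndex R ζ x}) := by
  have htop : ∀ x : ℝ, ζ < x → essBottom A ζ < x → resolventIndex R ζ x = ⊤ := by
    intro x hx hlt
    by_contra hne
    exact absurd (le_essBottom_iff.2 fun y hy hyx ↦
      h.notMem_essentialSpectrum hR hy hyx (lt_top_iff_ne_top.2 hne)) (not_le.2 hlt)
  by_cases hex : ∃ μ : ℝ, IsNthEigenvalue A (gapAbove A ζ) n μ
  · rw [nthLevel, dif_pos hex]
    obtain ⟨⟨hζμ, hμe⟩, -, hle, hlt⟩ := hex.choose_spec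
    set μ := hex.choose
    rw [← sInf_coe_image_Ioi μ]
    congr 2
    ext x
    constructor
    · intro hx
      refine ⟨hζμ.trans hx, ?_⟩
      rcases lt_or_ge (essBottom A ζ) (x : EReal) with hxe | hxe
      · rw [htop x (hζμ.trans hx) hxe]
        exact ENat.natCast_lt_top n
      · rw [h.resolventIndex_eq_eigCount hR (hζμ.trans hx) (le_essBottom_iff.1 hxe)]
        exact hlt.trans_le (eigCount_mono fun y hy _ ↦ ⟨hy.1.1, lt_of_le_of_lt hy.2 hx⟩)
    · rintro ⟨hζx, hn⟩
      by_contra hxμ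
      rw [Set.mem_Ioi, not_lt] at hxμ
      have hxe : (x : EReal) < essBottom A ζ := (EReal.coe_le_coe_iff.2 hxμ).trans_lt hμe
      rw [h.resolventIndex_eq_eigCount hR hζx (le_essBottom_iff.1 hxe.le)] at hn
      refine absurd (hn.trans_le ?_) (not_lt.2 hle)
      exact eigCount_mono fun y hy _ ↦
        ⟨⟨hy.1, (EReal.coe_lt_coe_iff.2 hy.2).trans hxe⟩, hy.2.trans_le hxμ⟩
  · rw [nthLevel, dif_neg hex]
    refine le_antisymm (le_sInf ?_) (le_of_forall_gt fun b hb ↦ ?_)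
    · rintro _ ⟨x, ⟨hx, hn⟩, rfl⟩
      by_contra hlt
      exact hex (h.exists_isNthEigenvalue hR hx hn (not_le.1 hlt))
    · obtain ⟨x, hx, hxb⟩ := EReal.lt_iff_exists_real_btwn.1 hb
      have hζx : ζ < x := EReal.coe_lt_coe_iff.1 (le_essBottom.trans_lt hx)
      have hn : n < resolventIndex R ζ x := by
        rw [htop x hζx hx]
        exact ENat.natCast_lt_top n
      have hmem : x ∈ {x : ℝ | ζ < x ∧ n < resolventIndex R ζ x} := ⟨hζx, hn⟩
      exact (sInf_le (Set.mem_image_of_mem _ hmem)).trans_lt hxb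

end Levels

/-! ### Operators D → D* represented by operators of D. -/

section Riesz

variable {D : Type*} [NormedAddCommGroup D] [InnerProductSpace ℂ D] [CompleteSpace D]

theorem exists_antiDual_eq (φ : AntiDual D) : ∃ v : D, ∀ u, φ u = ⟪u, v⟫_ℂ := by
  let ψ : D →L[ℂ] ℂ :=
    { toFun := fun u ↦ conj (φ u)
      map_add' := by simp
      map_smul' := by simp
      cont := by fun_prop }
  refine ⟨(InnerProductSpace.toDual ℂ D).symm ψ, fun u ↦ ?_⟩
  have h : ⟪(InnerProductSpace.toDual ℂ D).symm ψ, u⟫_ℂ = conj (φ u) :=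
    InnerProductSpace.toDual_symm_apply
  rw [← inner_conj_symm, h, Complex.conj_conj]

/-- If an operator `f : D → D*` is represented by a bijective operator of `D`, it is invertible. -/
theorem antiDual_inverse_apply {f : D →L[ℂ] AntiDual D} {g : D →L[ℂ] D} (hg : IsUnit g)
    (hf : ∀ w u, f w u = ⟪u, g w⟫_ℂ) (w : D) : f.inverse (f w) = w := by
  obtain ⟨g, rfl⟩ := hg
  have hgi : ∀ y, (g : D →L[ℂ] D) ((↑g⁻¹ : D →L[ℂ] D) y) = y := fun y ↦
    DFunLike.congr_fun g.mul_inv y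
  have hig : ∀ y, (↑g⁻¹ : D →L[ℂ] D) ((g : D →L[ℂ] D) y) = y := fun y ↦
    DFunLike.congr_fun g.inv_mul y
  have hinj : LinearMap.ker f.toLinearMap = ⊥ := by
    rw [LinearMap.ker_eq_bot']
    intro w hw
    have h1 : (g : D →L[ℂ] D) w = 0 := ext_inner_left ℂ fun u ↦ by
      rw [← hf, inner_zero_right]
      exact DFunLike.congr_fun hw u
    rw [← hig w, h1, map_zero]
  have hsurj : LinearMap.range f.toLinearMap = ⊤ := by
    rw [LinearMap.range_eq_top]
    intro φ
    obtain ⟨v, hv⟩ := exists_antiDual_eq φ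
    refine ⟨(↑g⁻¹ : D →L[ℂ] D) v, ContinuousLinearMap.ext fun u ↦ ?_⟩
    rw [hv]
    exact (hf _ _).trans (by rw [hgi])
  -- `ContinuousLinearMap.inverse` is 0 on non-invertible maps, so invertibility has to be supplied;
  -- it follows from bijectivity by the open mapping theorem.
  exact ContinuousLinearMap.IsInvertible.inverse_apply_eq
    ⟨ContinuousLinearEquiv.ofBijective f hinj hsurj, rfl⟩ |>.2 rfl

end Riesz

/-! ### Positivity of a pencil without spectrum on a half-line. -/

section Positivity

variable {D : Type*} [NormedAddCommGroup D] [InnerProductSpace ℂ D] [CompleteSpace D]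

/-- If `1 - r G` is invertible for all `r ≤ s`, then it is nonnegative for `r = s`. -/
theorem nonneg_one_sub_smul {G : D →L[ℂ] D} (hG : 0 ≤ G) {s : ℝ}
    (h : ∀ r ≤ s, IsUnit (1 - (r : ℂ) • G)) : 0 ≤ 1 - (s : ℂ) • G := by
  rcases le_or_gt s 0 with hs | hs
  · have h2 : 1 - (s : ℂ) • G = 1 + (-s) • G := by
      rw [neg_smul, ← sub_eq_add_neg]
      rfl
    rw [h2]
    exact add_nonneg zero_le_one (smul_nonneg (neg_nonneg.2 hs) hG)
  · have hsa : IsSelfAdjoint ((s : ℂ) • G) :=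
      IsSelfAdjoint.smul (show IsSelfAdjoint (s : ℂ) from Complex.conj_ofReal s)
        (IsSelfAdjoint.of_nonneg hG)
    have hsa' : IsSelfAdjoint (1 - (s : ℂ) • G) := (IsSelfAdjoint.one _).sub hsa
    rw [StarOrderedRing.nonneg_iff_spectrum_nonneg (R := ℝ) _ hsa']
    intro x hx
    by_contra hneg
    push Not at hneg
    refine hx ?_
    have h1x : 0 < 1 - x := by linarith
    have h1x' : (1 : ℂ) - x ≠ 0 := by exact_mod_cast h1x.ne'
    -- For x < 0 one has x − (1 − s G) = (x − 1)(1 − (s/(1 − x)) G), and s/(1 − x) ≤ s because s >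
    -- 0.
    have h2 := h (s / (1 - x)) ((div_le_iff₀ h1x).2 (by nlinarith))
    rw [spectrum.mem_resolventSet_iff]
    have h3 : algebraMap ℝ (D →L[ℂ] D) x - (1 - (s : ℂ) • G) =
        algebraMap ℂ (D →L[ℂ] D) (x - 1) * (1 - ((s / (1 - x) : ℝ) : ℂ) • G) := by
      have h4 : algebraMap ℝ (D →L[ℂ] D) x = (x : ℂ) • 1 := Algebra.algebraMap_eq_smul_one x
      rw [h4, Algebra.algebraMap_eq_smul_one, smul_one_mul, smul_sub, smul_smul]
      have h5 : ((x : ℂ) - 1) * ((s / (1 - x) : ℝ) : ℂ) = -s := by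
        push_cast
        field_simp
        ring
      rw [h5]
      module
    rw [h3]
    have h6 : (x : ℂ) - 1 ≠ 0 := fun h ↦ h1x' (by linear_combination -h)
    exact ((IsUnit.mk0 _ h6).map _).mul h2

end Positivity

/-! ### The transfer function and the resolvent of the angular extension. -/

namespace SymmBlockMatrix.Shifts

variable {H₁ H₂ : Type*} [NormedAddCommGroup H₁] [InnerProductSpace ℂ H₁]
  [NormedAddCommGroup H₂] [InnerProductSpace ℂ H₂] [CompleteSpace H₂]
  {M : SymmBlockMatrix H₁ H₂} (s : M.Shifts)

/-- The operator of `D₂` that represents `I₂* I₂`. -/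
noncomputable def gram₂ : s.D₂ →L[ℂ] s.D₂ := ContinuousLinearMap.adjoint s.I₂ ∘L s.I₂

theorem inner_gram₂ (u w : s.D₂) : ⟪u, s.gram₂ w⟫_ℂ = ⟪s.I₂ u, s.I₂ w⟫_ℂ := by
  rw [gram₂, ContinuousLinearMap.comp_apply, ContinuousLinearMap.adjoint_inner_right]

theorem gram₂_nonneg : 0 ≤ s.gram₂ := by
  rw [ContinuousLinearMap.nonneg_iff_isPositive]
  exact ContinuousLinearMap.isPositive_adjoint_comp_self s.I₂

/-- The operator of `D₂` that represents `x I₂* I₂ - T₂₂`. -/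
noncomputable def rep₂₂ (x : ℝ) : s.D₂ →L[ℂ] s.D₂ := 1 - ((s.τ - x : ℝ) : ℂ) • s.gram₂

theorem inner_rep₂₂ (x : ℝ) (u w : s.D₂) :
    ⟪u, s.rep₂₂ x w⟫_ℂ = ⟪u, w⟫_ℂ - (s.τ - x) * ⟪s.I₂ u, s.I₂ w⟫_ℂ := by
  rw [← inner_gram₂]
  rw [rep₂₂, sub_apply, inner_sub_right, smul_apply, inner_smul_right, one_apply_eq_self,
    Complex.ofReal_sub]

theorem op₂₂_apply (w u : s.D₂) :
    s.op₂₂ w u = s.τ * ⟪s.I₂ u, s.I₂ w⟫_ℂ - ⟪u, w⟫_ℂ := by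
  rw [op₂₂_eq]
  simp [-Complex.coe_smul]

theorem pencil₂₂_apply (x : ℝ) (w u : s.D₂) : s.pencil₂₂ x w u = ⟪u, (-s.rep₂₂ x) w⟫_ℂ := by
  have : s.pencil₂₂ x w u = s.op₂₂ w u - x * ⟪s.I₂ u, s.I₂ w⟫_ℂ := by
    simp [pencil₂₂, -Complex.coe_smul]
  rw [this, op₂₂_apply, neg_apply, inner_neg_right, inner_rep₂₂]
  ring

theorem isUnit_rep₂₂ {x : ℝ} (hx : (x : ℂ) ∈ opResolventSet s.friedrichs₂₂) :
    IsUnit (s.rep₂₂ x) := by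
  obtain ⟨R, hR⟩ := hx
  have hgraph : ∀ w : s.D₂, ∀ h : H₂, s.op₂₂ w = dualEmb s.I₂ h →
      ∃ hd : s.I₂ w ∈ s.friedrichs₂₂.domain, s.friedrichs₂₂ ⟨s.I₂ w, hd⟩ = h := by
    intro w h e
    have : (s.I₂ w, h) ∈ s.friedrichs₂₂.graph := by
      rw [friedrichs₂₂_graph]
      exact ⟨w, rfl, e⟩
    obtain ⟨a, ha, hb⟩ := (LinearPMap.mem_graph_iff _).1 this
    obtain ⟨a, hd⟩ := a
    obtain rfl : a = s.I₂ w := ha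
    exact ⟨hd, hb⟩
  have hinj : LinearMap.ker (s.rep₂₂ x).toLinearMap = ⊥ := by
    rw [LinearMap.ker_eq_bot']
    intro w hw
    have e : s.op₂₂ w = dualEmb s.I₂ ((x : ℂ) • s.I₂ w) := by
      refine ContinuousLinearMap.ext fun u ↦ ?_
      have h1 : ⟪u, s.rep₂₂ x w⟫_ℂ = 0 := by
        rw [show s.rep₂₂ x w = 0 from hw, inner_zero_right]
      rw [inner_rep₂₂] at h1
      rw [op₂₂_apply, dualEmb_apply, inner_smul_right]
      linear_combination -h1
    obtain ⟨hd, e'⟩ := hgraph _ _ e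
    have h2 := hR.1 ⟨_, hd⟩
    rw [e'] at h2
    refine s.injective_I₂ ?_
    simpa using h2.symm
  have hsurj : LinearMap.range (s.rep₂₂ x).toLinearMap = ⊤ := by
    rw [LinearMap.range_eq_top]
    intro f
    -- The resolvent in `H₂` only solves equations with right-hand sides in the range of I₂*. The
    -- ansatz f − w for the preimage of `f` achieves this: it requires (T₂₂^• − x) I₂ w = (τ − x) I₂
    -- f.
    obtain ⟨hd, e⟩ := hR.2 (((s.τ - x : ℝ) : ℂ) • s.I₂ f)
    have hg := s.friedrichs₂₂.mem_graph ⟨_, hd⟩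
    rw [friedrichs₂₂_graph] at hg
    obtain ⟨w, hw, hw'⟩ := hg
    refine ⟨f - w, ext_inner_left ℂ fun u ↦ ?_⟩
    have h1 := DFunLike.congr_fun hw' u
    simp only at hw h1
    rw [sub_eq_iff_eq_add.1 e, ← hw, op₂₂_apply, dualEmb_apply, inner_add_right, inner_smul_right,
      inner_smul_right] at h1
    change ⟪u, s.rep₂₂ x (f - w)⟫_ℂ = _
    rw [inner_rep₂₂, map_sub, inner_sub_right, inner_sub_right]
    push_cast at h1
    linear_combination h1
  exact ⟨(ContinuousLinearEquiv.ofBijective _ hinj hsurj).toUnit, rfl⟩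

variable [CompleteSpace H₁]

theorem op₁₁_apply (y u : s.D₁) : s.op₁₁ y u =
    s.κ * ⟪s.I₁ u, s.I₁ y⟫_ℂ + ⟪u, y⟫_ℂ - ⟪s.aux₂₁ u, s.aux₂₁ y⟫_ℂ := by
  rw [op₁₁_eq]
  simp [-Complex.coe_smul]

theorem op₁₂_apply (w : s.D₂) (u : s.D₁) : s.op₁₂ w u = ⟪s.aux₂₁ u, w⟫_ℂ := by
  rw [op₁₂_eq]
  simp

theorem op₂₁_apply (y : s.D₁) (u : s.D₂) : s.op₂₁ y u = ⟪u, s.aux₂₁ y⟫_ℂ := by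
  rw [op₂₁_eq]
  simp

theorem transfer_apply {x : ℝ} {C : s.D₂ →L[ℂ] s.D₂} (h1 : s.rep₂₂ x * C = 1)
    (h2 : C * s.rep₂₂ x = 1) (y u : s.D₁) : s.transfer x y u =
      (s.κ - x) * ⟪s.I₁ u, s.I₁ y⟫_ℂ + ⟪u, y⟫_ℂ - ⟪s.aux₂₁ u, s.aux₂₁ y⟫_ℂ +
        ⟪s.aux₂₁ u, C (s.aux₂₁ y)⟫_ℂ := by
  have hu : IsUnit (-s.rep₂₂ x) := IsUnit.neg ⟨⟨_, _, h1, h2⟩, rfl⟩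
  have e : s.op₂₁ y = s.pencil₂₂ x (-C (s.aux₂₁ y)) := by
    refine ContinuousLinearMap.ext fun u ↦ ?_
    rw [op₂₁_apply, pencil₂₂_apply, neg_apply, map_neg, neg_neg]
    have := DFunLike.congr_fun h1 (s.aux₂₁ y)
    rw [mul_apply_eq_comp] at this
    rw [this]
    rfl
  have e2 : (s.pencil₂₂ x).inverse (s.op₂₁ y) = -C (s.aux₂₁ y) := by
    rw [e]
    exact antiDual_inverse_apply hu (s.pencil₂₂_apply x) _
  have e3 : s.transfer x y u = s.op₁₁ y u - x * ⟪s.I₁ u, s.I₁ y⟫_ℂ -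
      s.op₁₂ ((s.pencil₂₂ x).inverse (s.op₂₁ y)) u := by
    simp [transfer, -Complex.coe_smul]
  rw [e3, e2, op₁₁_apply, op₁₂_apply, inner_neg_right]
  ring

theorem op_apply_eq (x y : s.D) : s.op x y =
    s.κ * ⟪s.I₁ y.fst, s.I₁ x.fst⟫_ℂ + ⟪y.fst, x.fst⟫_ℂ - ⟪s.aux₂₁ y.fst, s.aux₂₁ x.fst⟫_ℂ +
      ⟪s.aux₂₁ y.fst, x.snd⟫_ℂ + ⟪y.snd, s.aux₂₁ x.fst⟫_ℂ +
      s.τ * ⟪s.I₂ y.snd, s.I₂ x.snd⟫_ℂ - ⟪y.snd, x.snd⟫_ℂ := by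
  rw [op_apply, op₁₁_apply, op₁₂_apply, op₂₁_apply, op₂₂_apply]
  ring

theorem op_symm (x y : s.D) : s.op y x = conj (s.op x y) := by
  simp only [op_apply_eq, map_add, map_sub, map_mul, inner_conj_symm, Complex.conj_ofReal]
  ring

/-- Lifts the resolvent to `D`: with Y = I⁻¹ R one has (T − z I* I) Y = I*, an equation between
bounded forms that can be tested componentwise. -/
theorem exists_preimage {z : ℝ} {R : WithLp 2 (H₁ × H₂) →L[ℂ] WithLp 2 (H₁ × H₂)}
    (hR : IsResolventAt s.angularExtension z R) : ∃ Y : WithLp 2 (H₁ × H₂) →ₗ[ℂ] s.D,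
      (∀ h, s.I (Y h) = R h) ∧ ∀ h v, s.op (Y h) v = ⟪s.I v, h⟫_ℂ + z * ⟪s.I v, R h⟫_ℂ := by
  have hy : ∀ h, ∃ y, s.I y = R h ∧ ∀ v, s.op y v = ⟪s.I v, h⟫_ℂ + z * ⟪s.I v, R h⟫_ℂ := by
    intro h
    obtain ⟨hd, e⟩ := hR.2 h
    have hg := s.angularExtension.mem_graph ⟨_, hd⟩
    rw [angularExtension_graph] at hg
    obtain ⟨y, hy, hy'⟩ := hg
    refine ⟨y, hy, fun v ↦ ?_⟩
    have h1 := DFunLike.congr_fun hy' v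
    simp only at h1
    rw [h1, sub_eq_iff_eq_add.1 e, dualEmb_apply, inner_add_right, inner_smul_right]
  choose f hf hf' using hy
  refine ⟨{ toFun := f, map_add' := fun a b ↦ s.injective_I ?_,
            map_smul' := fun c a ↦ s.injective_I ?_ }, hf, hf'⟩
  · rw [map_add, hf, hf, hf, map_add]
  · rw [RingHom.id_apply, map_smul, hf, hf, map_smul]

theorem isSelfAdjoint_resolvent {z : ℝ} {R : WithLp 2 (H₁ × H₂) →L[ℂ] WithLp 2 (H₁ × H₂)}
    (hR : IsResolventAt s.angularExtension z R) : IsSelfAdjoint R := by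
  obtain ⟨Y, hY, hY'⟩ := s.exists_preimage hR
  rw [ContinuousLinearMap.isSelfAdjoint_iff_isSymmetric]
  intro a b
  change ⟪R a, b⟫_ℂ = ⟪a, R b⟫_ℂ
  have h1 := hY' b (Y a)
  have h2 := congrArg conj (hY' a (Y b))
  rw [← op_symm, h1, map_add, map_mul, inner_conj_symm, inner_conj_symm, Complex.conj_ofReal, hY,
    hY] at h2
  exact add_right_cancel h2

/-- An instance of `negIndex_schur` with S(ζ) and Q = t + 0 ⊕ G as diagonal entries, where t = (x −
ζ)⁻¹ and G = I₂ C I₂† is (ζ − T₂₂^•)⁻¹. The two Schur complements are S(x) and t − R. -/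
theorem negIndex_transfer {ζ x : ℝ} (hx : ζ < x)
    {R : WithLp 2 (H₁ × H₂) →L[ℂ] WithLp 2 (H₁ × H₂)}
    (hR : IsResolventAt s.angularExtension ζ R)
    (h₂ : ∀ x : ℝ, ζ ≤ x → (x : ℂ) ∈ opResolventSet s.friedrichs₂₂) :
    negIndex (s.transfer x) = negIndex (s.transfer ζ) + resolventIndex R ζ x := by
  obtain ⟨Y, hY, hY'⟩ := s.exists_preimage hR
  obtain ⟨Nζ, hNζ⟩ := s.isUnit_rep₂₂ (h₂ ζ le_rfl)
  obtain ⟨Nx, hNx⟩ := s.isUnit_rep₂₂ (h₂ x hx.le)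
  set C : s.D₂ →L[ℂ] s.D₂ := ↑Nζ⁻¹ with hC
  set C' : s.D₂ →L[ℂ] s.D₂ := ↑Nx⁻¹ with hC'
  have c1 : s.rep₂₂ ζ * C = 1 := by rw [← hNζ, hC, Units.mul_inv]
  have c2 : C * s.rep₂₂ ζ = 1 := by rw [← hNζ, hC, Units.inv_mul]
  have c1' : s.rep₂₂ x * C' = 1 := by rw [← hNx, hC', Units.mul_inv]
  have c2' : C' * s.rep₂₂ x = 1 := by rw [← hNx, hC', Units.inv_mul]
  have a1 : ∀ w, s.rep₂₂ ζ (C w) = w := fun w ↦ DFunLike.congr_fun c1 w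
  have a2 : ∀ w, C (s.rep₂₂ ζ w) = w := fun w ↦ DFunLike.congr_fun c2 w
  have hne : x - ζ ≠ 0 := (sub_pos.2 hx).ne'
  have hneC : (x : ℂ) - ζ ≠ 0 := by exact_mod_cast hne
  -- For r ≤ τ − ζ the operator 1 − r I₂† I₂ is `rep₂₂` at the point τ − r ≥ ζ, hence invertible.
  have hpos : 0 ≤ s.rep₂₂ ζ := by
    refine nonneg_one_sub_smul s.gram₂_nonneg fun r hr ↦ ?_
    have := s.isUnit_rep₂₂ (h₂ (s.τ - r) (by linarith))
    rwa [rep₂₂, sub_sub_cancel] at this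
  rw [ContinuousLinearMap.nonneg_iff_isPositive] at hpos
  have hsymm : ∀ u w, ⟪s.rep₂₂ ζ u, w⟫_ℂ = ⟪u, s.rep₂₂ ζ w⟫_ℂ :=
    hpos.isSelfAdjoint.isSymmetric
  have hCsymm : ∀ u w, ⟪C u, w⟫_ℂ = ⟪u, C w⟫_ℂ := fun u w ↦ by
    rw [← a1 w, ← hsymm, a1, a1]
  have hCpos : ∀ w, 0 ≤ (⟪w, C w⟫_ℂ).re := fun w ↦ by
    have := hpos.re_inner_nonneg_left (C w)
    rwa [a1] at this
  -- The resolvent identity for the pencil.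
  have hCC : ∀ w, C w = C' w + ((x : ℂ) - ζ) • C (s.gram₂ (C' w)) := by
    intro w
    have e1 : s.rep₂₂ x (C' w) = w := DFunLike.congr_fun c1' w
    have e2 : s.rep₂₂ x (C' w) = s.rep₂₂ ζ (C' w) + ((x : ℂ) - ζ) • s.gram₂ (C' w) := by
      simp only [rep₂₂, sub_apply, smul_apply, one_apply_eq_self, Complex.ofReal_sub]
      module
    rw [e1] at e2
    nth_rewrite 1 [e2]
    rw [map_add, a2, map_smul]
  let e := (WithLp.linearEquiv 2 ℂ (H₁ × H₂)).symm
  let G : H₂ →L[ℂ] H₂ := s.I₂ ∘L C ∘L ContinuousLinearMap.adjoint s.I₂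
  have hGsymm : ∀ a b, ⟪G a, b⟫_ℂ = ⟪a, G b⟫_ℂ := fun a b ↦ by
    simp only [G, ContinuousLinearMap.comp_apply]
    rw [← ContinuousLinearMap.adjoint_inner_right, hCsymm, ContinuousLinearMap.adjoint_inner_left]
  have hGpos : ∀ a, 0 ≤ (⟪a, G a⟫_ℂ).re := fun a ↦ by
    simp only [G, ContinuousLinearMap.comp_apply]
    rw [← ContinuousLinearMap.adjoint_inner_left]
    exact hCpos _
  set t : ℝ := (x - ζ)⁻¹ with ht
  have htC : (t : ℂ) = ((x : ℂ) - ζ)⁻¹ := by rw [ht]; push_cast; rfl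
  have ht0 : 0 ≤ t := (inv_pos.2 (sub_pos.2 hx)).le
  let J : s.D₁ →ₗ[ℂ] WithLp 2 (H₁ × H₂) :=
    e.toLinearMap ∘ₗ s.I₁.toLinearMap.prod (s.I₂ ∘L C ∘L s.aux₂₁).toLinearMap
  let K : s.D₁ →ₗ[ℂ] WithLp 2 (H₁ × H₂) :=
    ((x : ℂ) - ζ) • (e.toLinearMap ∘ₗ s.I₁.toLinearMap.prod (s.I₂ ∘L C' ∘L s.aux₂₁).toLinearMap)
  let Q : WithLp 2 (H₁ × H₂) →ₗ[ℂ] WithLp 2 (H₁ × H₂) :=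
    (t : ℂ) • LinearMap.id + e.toLinearMap ∘ₗ LinearMap.inr ℂ H₁ H₂ ∘ₗ G.toLinearMap ∘ₗ
      (WithLp.sndL 2 ℂ H₁ H₂).toLinearMap
  have hQ : ∀ h k, ⟪h, Q k⟫_ℂ = t * ⟪h, k⟫_ℂ + ⟪h.snd, G k.snd⟫_ℂ := by
    intro h k
    change ⟪h, (t : ℂ) • k + WithLp.toLp 2 ((0 : H₁), G k.snd)⟫_ℂ = _
    rw [inner_add_right, inner_smul_right]
    simp [WithLp.prod_inner_apply]
  have hRsa := s.isSelfAdjoint_resolvent hR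
  have hRsymm : ∀ a b, ⟪R a, b⟫_ℂ = ⟪a, R b⟫_ℂ := hRsa.isSymmetric
  have hI : ∀ v : s.D, s.I v = WithLp.toLp 2 (s.I₁ v.fst, s.I₂ v.snd) := s.I_apply
  -- The second row of (T − ζ I* I) Y h = I* h, from testing with (0, u); the first row follows in
  -- `hfst`.
  have hsnd : ∀ h, C (s.aux₂₁ (Y h).fst) =
      (Y h).snd + C (ContinuousLinearMap.adjoint s.I₂ h.snd) := by
    intro h
    have e1 : s.aux₂₁ (Y h).fst =
        s.rep₂₂ ζ (Y h).snd + ContinuousLinearMap.adjoint s.I₂ h.snd := by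
      refine ext_inner_left ℂ fun u ↦ ?_
      have := hY' h (WithLp.toLp 2 (0, u))
      rw [op_apply_eq, ← hY, hI, hI] at this
      simp [WithLp.prod_inner_apply] at this
      rw [inner_add_right, inner_rep₂₂, ContinuousLinearMap.adjoint_inner_right]
      linear_combination this
    rw [e1, map_add, a2]
  have hfst : ∀ h v, s.op₁₁ (Y h).fst v + ⟪s.aux₂₁ v, (Y h).snd⟫_ℂ =
      ⟪s.I₁ v, h.fst⟫_ℂ + ζ * ⟪s.I₁ v, s.I₁ (Y h).fst⟫_ℂ := by
    intro h v
    have := hY' h (WithLp.toLp 2 (v, 0))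
    rw [op_apply_eq, ← hY, hI, hI] at this
    simp [WithLp.prod_inner_apply] at this
    rw [op₁₁_apply]
    linear_combination this
  have key := negIndex_schur (S := s.transfer ζ) (S' := s.transfer x)
    (E := (t : ℂ) • 1 - R) (Q := Q) J K ((WithLp.fstL 2 ℂ s.D₁ s.D₂).toLinearMap ∘ₗ Y)
    ?_ ?_ ?_ ?_ ?_ ?_ ?_ ?_
  · rw [key]
    congr 1
    refine congrArg formIndex (funext fun h ↦ ?_)
    rw [sub_apply, inner_sub_right, smul_apply, inner_smul_right, one_apply_eq_self,
      inner_self_eq_norm_sq_to_K, Complex.sub_re, Complex.re_ofReal_mul]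
    simp [← Complex.ofReal_pow, ← ht]
  · intro y u
    rw [s.transfer_apply c1 c2, s.transfer_apply c1 c2]
    simp only [map_add, map_sub, map_mul, inner_conj_symm, Complex.conj_ofReal]
    rw [hCsymm]
  · intro a b
    simp only [sub_apply, smul_apply, one_apply_eq_self, inner_sub_left, inner_sub_right,
      inner_smul_left, inner_smul_right, Complex.conj_ofReal, hRsymm]
  · intro a b
    rw [← inner_conj_symm, hQ, hQ, map_add, map_mul, inner_conj_symm, inner_conj_symm,
      Complex.conj_ofReal, hGsymm]
  · intro a
    rw [hQ, Complex.add_re, Complex.re_ofReal_mul]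
    have h0 : 0 ≤ (⟪a, a⟫_ℂ).re := inner_self_nonneg (𝕜 := ℂ) (x := a)
    exact add_nonneg (mul_nonneg ht0 h0) (hGpos _)
  -- Eliminating the second component of Y h from the first row turns it into S(ζ) (Y h)₁ = J* h.
  · intro h v
    change s.transfer ζ (Y h).fst v = ⟪WithLp.toLp 2 (s.I₁ v, s.I₂ (C (s.aux₂₁ v))), h⟫_ℂ
    have e1 := hfst h v
    rw [op₁₁_apply] at e1
    rw [s.transfer_apply c1 c2, hsnd, WithLp.prod_inner_apply]
    change _ = ⟪s.I₁ v, h.fst⟫_ℂ + ⟪s.I₂ (C (s.aux₂₁ v)), h.snd⟫_ℂ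
    rw [← ContinuousLinearMap.adjoint_inner_right s.I₂, hCsymm, inner_add_right]
    linear_combination e1
  -- By the second row J (Y h)₁ = R h + (0, G h₂), and the `G`-term of `Q` cancels.
  · intro h
    change ((t : ℂ) • 1 - R) h = ((t : ℂ) • h + WithLp.toLp 2 ((0 : H₁), G h.snd)) -
      WithLp.toLp 2 (s.I₁ (Y h).fst, s.I₂ (C (s.aux₂₁ (Y h).fst)))
    rw [hsnd, sub_apply, ← hY, hI, map_add]
    have : WithLp.toLp 2 (s.I₁ (Y h).fst, s.I₂ (Y h).snd + G h.snd) =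
      WithLp.toLp 2 (s.I₁ (Y h).fst, s.I₂ (Y h).snd) + WithLp.toLp 2 ((0 : H₁), G h.snd) := by
      rw [← WithLp.toLp_add]; simp
    change _ = _ - WithLp.toLp 2 (s.I₁ (Y h).fst, s.I₂ (Y h).snd + G h.snd)
    rw [this]
    simp only [smul_apply, one_apply_eq_self]
    abel
  · intro u
    have e1 : s.I₂ (C (s.aux₂₁ u)) = s.I₂ (C' (s.aux₂₁ u)) +
        ((x : ℂ) - ζ) • G (s.I₂ (C' (s.aux₂₁ u))) := by
      rw [hCC, map_add, map_smul]
      rfl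
    change (t : ℂ) • (((x : ℂ) - ζ) • WithLp.toLp 2 (s.I₁ u, s.I₂ (C' (s.aux₂₁ u)))) +
      WithLp.toLp 2 ((0 : H₁), G (((x : ℂ) - ζ) • s.I₂ (C' (s.aux₂₁ u)))) =
        WithLp.toLp 2 (s.I₁ u, s.I₂ (C (s.aux₂₁ u)))
    rw [htC, inv_smul_smul₀ hneC, ← WithLp.toLp_add, e1, map_smul]
    simp
  -- S(ζ) − S(x) contains (x − ζ) I₁* I₁ and the difference C − C', which `hCC` turns into (x − ζ) C
  -- I₂† I₂ C'.
  · intro u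
    change _ = _ - ⟪WithLp.toLp 2 (s.I₁ u, s.I₂ (C (s.aux₂₁ u))),
      ((x : ℂ) - ζ) • WithLp.toLp 2 (s.I₁ u, s.I₂ (C' (s.aux₂₁ u)))⟫_ℂ
    rw [s.transfer_apply c1 c2, s.transfer_apply c1' c2', inner_smul_right,
      WithLp.prod_inner_apply]
    change _ = _ - _ * (⟪s.I₁ u, s.I₁ u⟫_ℂ + ⟪s.I₂ (C (s.aux₂₁ u)), s.I₂ (C' (s.aux₂₁ u))⟫_ℂ)
    rw [← inner_gram₂, hCsymm]
    have e1 := congrArg (fun w ↦ ⟪s.aux₂₁ u, w⟫_ℂ) (hCC (s.aux₂₁ u))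
    simp only [inner_add_right, inner_smul_right] at e1
    rw [e1]
    ring

end SymmBlockMatrix.Shifts

theorem mainTheorem5 {H₁ H₂ : Type*}
    [NormedAddCommGroup H₁] [InnerProductSpace ℂ H₁] [CompleteSpace H₁]
    [NormedAddCommGroup H₂] [InnerProductSpace ℂ H₂] [CompleteSpace H₂]
    (M : SymmBlockMatrix H₁ H₂) (s : M.Shifts) (ζ : ℝ)
    (hζ : (ζ : ℂ) ∈ opResolventSet s.angularExtension)
    (hζ₂ : ∀ x : ℝ, ζ ≤ x → (x : ℂ) ∈ opResolventSet s.friedrichs₂₂)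
    (hind : negIndex (s.transfer ζ) < ⊤) (n : ℕ) :
    nthLevel s.angularExtension ζ n =
      sInf ((fun x : ℝ ↦ (x : EReal)) ''
        {x : ℝ | ζ < x ∧ negIndex (s.transfer ζ) + n < negIndex (s.transfer x)}) := by
  obtain ⟨R, hR⟩ := hζ
  rw [hR.nthLevel_eq_sInf (s.isSelfAdjoint_resolvent hR)]
  congr 2
  ext x
  refine and_congr_right fun hx ↦ ?_
  -- Cancellation in `ℕ∞` is legitimate because ind S(ζ) is finite.
  rw [s.negIndex_transfer hx hR hζ₂, ENat.add_lt_add_iff_left hind.ne]
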